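/- Notation. Let $d\ge 1$ and $1\le k<d$. For a linear map $T$ write $s_1(T)\ge s_2(T)\ge\cdots$ for its singular values. Let $\operatorname{PF}(k-1,k+1)$ be the space of partial flags $V_{k-1}\subset V_{k+1}\subseteq\mathbb{R}^d$ with $\dim V_i=i$, and let $m$ be its Haar measure, i.e. the $O(d)$-invariant Borel probability measure. The miniflag of $F=(V_{k-1},V_{k+1})$ is the set $\mathcal F(F)$ of all $k$-dimensional subspaces $V_k$ with $V_{k-1}\subset V_k\subset V_{k+1}$. A matrix $A\in\operatorname{GL}(d,\mathbb{R})$ maps $F$ to $AF=(AV_{k-1},AV_{k+1})$ and induces a map $\mathcal F(F)\to\mathcal F(AF)$, $V_k\mapsto AV_k$. Entropy. If $\eta$ is a probability measure on maps $f\colon X\to Y$ and $\nu$ is a probability measure on $X$, put $\eta*\nu=\int f_*\nu\,d\eta(f)$, $\Phi_\eta(\nu)=\int d_{\mathrm{KL}}(f_*\nu\,|\,\eta*\nu)\,d\eta(f)$ and $h(\eta)=\inf_\nu\Phi_\eta(\nu)\in[0,\infty]$, where $d_{\mathrm{KL}}$ is the Kullback–Leibler divergence and the infimum is over all probability measures $\nu$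 on $X$. Let $\mu$ be a Borel probability measure on $\operatorname{GL}(d,\mathbb{R})$ and $F_1\in\operatorname{PF}(k-1,k+1)$. Let $\bar\mu_{F_1}$ be the distribution of $AF_1$ for $A\sim\mu$, and $\mu_{F_1,F_2}$ the conditional distribution of $A\sim\mu$ given $AF_1=F_2$, viewed as a law of random maps $\mathcal F(F_1)\to\mathcal F(F_2)$. The fiber-averaged push-forward entropy is $$h_{\mathrm{FA}}(F_1,\mu)=\int h(\mu_{F_1,F_2})\,d\bar\mu_{F_1}(F_2)\in[0,\infty].$$ The constant. For $B\in\operatorname{GL}(d,\mathbb{R})$ and subspaces $U\subseteq V$ of $\mathbb{R}^d$ let $V\ominus U=V\cap U^\perp$ and $B|_{V\perp U}=\operatorname{proj}_{BV\ominus BU}\,B\,\operatorname{proj}_{V\ominus U}$, where $\operatorname{proj}_W$ is the orthogonal projection onto $W$. Call $C\in\mathbb{R}$ a gap constant for $d$ if for all $1\le k<d$ and all $B\in\operatorname{GL}(d,\mathbb{R})$ the function under the integral below is $m$-integrable and $$\left|\int_{\operatorname{PF}(k-1,k+1)}\log\frac{s_1(B|_{V_{k+1}\perp V_{k-1}})}{s_2(B|_{V_{k+1}\perp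 V_{k-1}})}\,dm(V_{k-1},V_{k+1})-\log\frac{s_k(B)}{s_{k+1}(B)}\right|\le C.$$ Statement. For every $d$ a gap constant exists, and whenever $C_d$ is a gap constant for $d$, then for all $1\le k<d$ and every Borel probability measure $\mu$ on $\operatorname{GL}(d,\mathbb{R})$, $$\mathbb{E}_\mu\big[\log s_k(A)-\log s_{k+1}(A)\big]\ \ge\ \int_{\operatorname{PF}(k-1,k+1)}h_{\mathrm{FA}}(F,\mu)\,dm(F)-C_d .$$ Both the expectation and the integral of $h_{\mathrm{FA}}$ are integrals of non-negative functions and may be $+\infty$. In particular $C_d$ depends on $d$ only. -/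

import Mathlib

open MeasureTheory ProbabilityTheory InformationTheory Module
open scoped ENNReal

noncomputable section

namespace Miniflag

/-! ### Matrices acting on Euclidean space -/

/-- The linear map of `ℝ^d` given by an invertible matrix. -/
abbrev lin {d : ℕ} (A : GL (Fin d) ℝ) : EuclideanSpace ℝ (Fin d) →ₗ[ℝ] EuclideanSpace ℝ (Fin d) :=
  Matrix.toEuclideanLin (A : Matrix (Fin d) (Fin d) ℝ)

theorem lin_injective {d : ℕ} (A : GL (Fin d) ℝ) : Function.Injective (lin A) := by
  have h : lin A⁻¹ ∘ₗ lin A = LinearMap.id := by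
    rw [← Matrix.toLpLin_mul_same, ← Units.val_mul, inv_mul_cancel, Units.val_one,
      Matrix.toLpLin_one]
  intro x y hxy
  have h' := congrArg (lin A⁻¹) hxy
  rwa [← LinearMap.comp_apply, ← LinearMap.comp_apply, h] at h'

theorem finrank_map_lin {d : ℕ} (A : GL (Fin d) ℝ)
    (V : Submodule ℝ (EuclideanSpace ℝ (Fin d))) : finrank ℝ (V.map (lin A)) = finrank ℝ V :=
  (Submodule.equivMapOfInjective (lin A) (lin_injective A) V).finrank_eq.symm

/-- The `k`-th largest singular value `s_k(T)`, `k = 1, 2, …` (Mathlib counts from `0`). -/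
def sv {d : ℕ} (T : EuclideanSpace ℝ (Fin d) →ₗ[ℝ] EuclideanSpace ℝ (Fin d)) (k : ℕ) : ℝ :=
  T.singularValues (k - 1)

/-- `GL(d, ℝ)` carries its Borel σ-algebra. -/
instance instMeasurableSpaceGL (d : ℕ) : MeasurableSpace (GL (Fin d) ℝ) := borel _

instance instBorelSpaceGL (d : ℕ) : BorelSpace (GL (Fin d) ℝ) := ⟨rfl⟩

theorem isClosedEmbedding_embedProduct (d : ℕ) :
    Topology.IsClosedEmbedding (Units.embedProduct (Matrix (Fin d) (Fin d) ℝ)) := by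
  refine ⟨Units.isEmbedding_embedProduct, ?_⟩
  have h : Set.range (Units.embedProduct (Matrix (Fin d) (Fin d) ℝ)) =
      {p | p.1 * p.2.unop = 1} ∩ {p | p.2.unop * p.1 = 1} := by
    ext p
    constructor
    · rintro ⟨u, rfl⟩
      simp
    · rintro ⟨h1, h2⟩
      exact ⟨⟨p.1, p.2.unop, h1, h2⟩, rfl⟩
  rw [h]
  exact (isClosed_eq (continuous_fst.mul (MulOpposite.continuous_unop.comp continuous_snd))
    continuous_const).inter
    (isClosed_eq ((MulOpposite.continuous_unop.comp continuous_snd).mul continuous_fst)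
    continuous_const)

instance instPolishSpaceGL (d : ℕ) : PolishSpace (GL (Fin d) ℝ) := by
  have : PolishSpace (Matrix (Fin d) (Fin d) ℝ) :=
    inferInstanceAs (PolishSpace (Fin d → Fin d → ℝ))
  have : PolishSpace (Matrix (Fin d) (Fin d) ℝ)ᵐᵒᵖ :=
    (MulOpposite.opHomeomorph (M := Matrix (Fin d) (Fin d) ℝ)).symm.isClosedEmbedding.polishSpace
  exact (isClosedEmbedding_embedProduct d).polishSpace

/-! ### Grassmannians and partial flags -/

/-- The Grassmannian `Gr(k, d)` of `k`-planes in `ℝ^d`. -/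
@[ext] structure Gr (d k : ℕ) where
  space : Submodule ℝ (EuclideanSpace ℝ (Fin d))
  finrank_space : finrank ℝ space = k

/-- The space `PF(i, j)` of partial flags `V_i ⊆ V_j ⊆ ℝ^d` with `dim V_i = i`, `dim V_j = j`. -/
@[ext] structure PF (d i j : ℕ) where
  lo : Submodule ℝ (EuclideanSpace ℝ (Fin d))
  hi : Submodule ℝ (EuclideanSpace ℝ (Fin d))
  finrank_lo : finrank ℝ lo = i
  finrank_hi : finrank ℝ hi = j
  lo_le_hi : lo ≤ hi

/-- The usual topology of the Grassmannian: a subspace is identified with the orthogonal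
projection onto it. -/
instance instTopologicalSpaceGr (d k : ℕ) : TopologicalSpace (Gr d k) :=
  TopologicalSpace.induced (fun V => V.space.starProjection) inferInstance

instance instMeasurableSpaceGr (d k : ℕ) : MeasurableSpace (Gr d k) := borel _

instance instBorelSpaceGr (d k : ℕ) : BorelSpace (Gr d k) := ⟨rfl⟩

/-- The usual topology of the space of partial flags: a flag is identified with the pair of
orthogonal projections onto its two members. -/
instance instTopologicalSpacePF (d i j : ℕ) : TopologicalSpace (PF d i j) :=
  TopologicalSpace.induced (fun F => (F.lo.starProjection, F.hi.starProjection)) inferInstance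

instance instMeasurableSpacePF (d i j : ℕ) : MeasurableSpace (PF d i j) := borel _

instance instBorelSpacePF (d i j : ℕ) : BorelSpace (PF d i j) := ⟨rfl⟩

/-- The image `A V` of a `k`-plane. -/
def Gr.act {d k : ℕ} (A : GL (Fin d) ℝ) (V : Gr d k) : Gr d k where
  space := V.space.map (lin A)
  finrank_space := (finrank_map_lin A V.space).trans V.finrank_space

/-- The image `(A V_i, A V_j)` of a partial flag. -/
def PF.act {d i j : ℕ} (A : GL (Fin d) ℝ) (F : PF d i j) : PF d i j where
  lo := F.lo.map (lin A)
  hi := F.hi.map (lin A)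
  finrank_lo := (finrank_map_lin A F.lo).trans F.finrank_lo
  finrank_hi := (finrank_map_lin A F.hi).trans F.finrank_hi
  lo_le_hi := Submodule.map_mono F.lo_le_hi

theorem pred_le_succ (k : ℕ) : k - 1 ≤ k + 1 := (Nat.sub_le k 1).trans (Nat.le_succ k)

/-- The miniflag `𝓕(V_{k-1}, V_{k+1})`: all `k`-planes `V_k` with `V_{k-1} ⊆ V_k ⊆ V_{k+1}`. -/
def fiber {d k : ℕ} (F : PF d (k - 1) (k + 1)) : Set (Gr d k) :=
  {V | F.lo ≤ V.space ∧ V.space ≤ F.hi}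

/-! ### The Haar measure on partial flags -/

/-- `O(d)` carries its Borel σ-algebra. -/
instance instMeasurableSpaceO (d : ℕ) : MeasurableSpace (Matrix.orthogonalGroup (Fin d) ℝ) :=
  borel _

instance instBorelSpaceO (d : ℕ) : BorelSpace (Matrix.orthogonalGroup (Fin d) ℝ) := ⟨rfl⟩

instance instCompactSpaceO (d : ℕ) : CompactSpace (Matrix.orthogonalGroup (Fin d) ℝ) := by
  have hK : IsCompact (Set.matrix (Metric.closedBall (0 : ℝ) 1) : Set (Matrix (Fin d) (Fin d) ℝ)) :=
    (isCompact_closedBall (0 : ℝ) 1).matrix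
  refine isCompact_iff_compactSpace.mp (hK.of_isClosed_subset isClosed_unitary ?_)
  intro U hU i j
  rw [mem_closedBall_zero_iff]
  exact entry_norm_bound_of_unitary hU i j

/-- The coordinate subspace `lin(e_1, …, e_i)` of `ℝ^d`. -/
def coordSpace (d i : ℕ) : Submodule ℝ (EuclideanSpace ℝ (Fin d)) :=
  Submodule.span ℝ (Set.range fun n : {n : Fin d // (n : ℕ) < i} =>
    EuclideanSpace.single (n : Fin d) (1 : ℝ))

theorem finrank_coordSpace {d i : ℕ} (h : i ≤ d) : finrank ℝ (coordSpace d i) = i := by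
  have hli : LinearIndependent ℝ (fun n : {n : Fin d // (n : ℕ) < i} =>
      EuclideanSpace.single (n : Fin d) (1 : ℝ)) := by
    have h0 := (EuclideanSpace.basisFun (Fin d) ℝ).toBasis.linearIndependent.comp
      (fun n : {n : Fin d // (n : ℕ) < i} => (n : Fin d)) Subtype.val_injective
    simpa [Function.comp_def] using h0
  rw [coordSpace, finrank_span_eq_card hli]
  rw [Fintype.card_congr (β := Fin i)
    ⟨fun n => ⟨n.1, n.2⟩, fun n => ⟨⟨n, n.2.trans_le h⟩, n.2⟩, fun _ => rfl, fun _ => rfl⟩]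
  exact Fintype.card_fin i

theorem coordSpace_mono (d : ℕ) {i j : ℕ} (h : i ≤ j) : coordSpace d i ≤ coordSpace d j := by
  refine Submodule.span_mono ?_
  rintro _ ⟨⟨n, hn⟩, rfl⟩
  exact ⟨⟨n, hn.trans_le h⟩, rfl⟩

/-- The coordinate flag. -/
def coordFlag {d i j : ℕ} (hij : i ≤ j) (hjd : j ≤ d) : PF d i j where
  lo := coordSpace d i
  hi := coordSpace d j
  finrank_lo := finrank_coordSpace (hij.trans hjd)
  finrank_hi := finrank_coordSpace hjd
  lo_le_hi := coordSpace_mono d hij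

/-- The normalized Haar measure on `PF(i, j)`, i.e. its `O(d)`-invariant Borel probability measure:
the image of the normalized Haar measure of `O(d)` under an orbit map `g ↦ g F₀`. -/
def haarPF {d i j : ℕ} (hij : i ≤ j) (hjd : j ≤ d) : Measure (PF d i j) :=
  (Measure.haarMeasure
    (⊤ : TopologicalSpace.PositiveCompacts (Matrix.orthogonalGroup (Fin d) ℝ))).map fun g =>
      PF.act (Unitary.toUnits g) (coordFlag hij hjd)

/-! ### Entropy of a random map

A random map `X → Y` is given by a law `μ` on a parameter space `Ω` and maps `f ω : X → Y`. -/

section Entropy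

variable {Ω X Y : Type*} [MeasurableSpace Ω] [MeasurableSpace X] [MeasurableSpace Y]

/-- The mean push-forward `μ * ν = ∫ (f ω)_* ν dμ(ω)`. -/
def meanPush (f : Ω → X → Y) (μ : Measure Ω) (ν : Measure X) : Measure Y :=
  μ.bind fun ω => ν.map (f ω)

/-- The Furstenberg entropy `Φ_μ(ν) = ∫ d_KL((f ω)_* ν | μ * ν) dμ(ω)`. -/
def furstenbergEntropy (f : Ω → X → Y) (μ : Measure Ω) (ν : Measure X) : ℝ≥0∞ :=
  ∫⁻ ω, klDiv (ν.map (f ω)) (meanPush f μ ν) ∂μ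

/-- The push-forward entropy `h(μ)`: the infimum of `Φ_μ(ν)` over all probability measures `ν`
on `X`. -/
def pushforwardEntropy (f : Ω → X → Y) (μ : Measure Ω) : ℝ≥0∞ :=
  ⨅ ν : ProbabilityMeasure X, furstenbergEntropy f μ (ν : Measure X)

end Entropy

/-- The action of matrices on the points of the miniflag over `F`; the image point lies in the
miniflag over `A F`, which is a subset of `Gr(k, d)`. -/
def fiberMap {d k : ℕ} (F : PF d (k - 1) (k + 1)) (A : GL (Fin d) ℝ) (V : fiber F) : Gr d k :=
  Gr.act A V

theorem fiberMap_mem {d k : ℕ} (F : PF d (k - 1) (k + 1)) (A : GL (Fin d) ℝ) (V : fiber F) :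
    fiberMap F A V ∈ fiber (PF.act A F) :=
  ⟨Submodule.map_mono V.2.1, Submodule.map_mono V.2.2⟩

/-- The conditional distribution `μ_{F₁,F₂}` of `A ∼ μ` given `A F₁ = F₂` (as a function of `F₂`,
defined for almost all `F₂` with respect to the law of `A F₁`). -/
def condLaw {d i j : ℕ} (μ : Measure (GL (Fin d) ℝ)) [IsFiniteMeasure μ] (F₁ F₂ : PF d i j) :
    Measure (GL (Fin d) ℝ) :=
  condDistrib id (fun A : GL (Fin d) ℝ => PF.act A F₁) μ F₂

/-- The fiber-averaged push-forward entropy `h_FA(F₁, μ)`: the mean of `h(μ_{F₁,F₂})` when `F₂`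
is distributed as the image `A F₁`, `A ∼ μ`. -/
def hFA {d k : ℕ} (F₁ : PF d (k - 1) (k + 1)) (μ : Measure (GL (Fin d) ℝ)) [IsFiniteMeasure μ] :
    ℝ≥0∞ :=
  ∫⁻ F₂, pushforwardEntropy (fiberMap F₁) (condLaw μ F₁ F₂) ∂(μ.map fun A => PF.act A F₁)

/-! ### The constant -/

/-- The map `B|_{V ⊥ U} = proj_{B(V) ⊖ B(U)} B proj_{V ⊖ U}` for `(U, V)` a partial flag, where
`V ⊖ U = V ∩ Uᗮ`. -/
def perpMap {d i j : ℕ} (B : GL (Fin d) ℝ) (F : PF d i j) :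
    EuclideanSpace ℝ (Fin d) →ₗ[ℝ] EuclideanSpace ℝ (Fin d) :=
  ((PF.act B F).hi ⊓ (PF.act B F).loᗮ).starProjection.toLinearMap ∘ₗ lin B ∘ₗ
    (F.hi ⊓ F.loᗮ).starProjection.toLinearMap

/-- `C` bounds, for all `1 ≤ k < d` and all `B ∈ GL(d, ℝ)`, the difference between the Haar average
of the logarithmic singular value gap of `B` on `V_{k+1} ⊖ V_{k-1}` and the `k`-th logarithmic
singular value gap of `B`. -/
def IsGapConstant (d : ℕ) (C : ℝ) : Prop :=
  ∀ (k : ℕ) (_ : 1 ≤ k) (hkd : k < d) (B : GL (Fin d) ℝ),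
    Integrable (fun F : PF d (k - 1) (k + 1) => Real.log (sv (perpMap B F) 1 / sv (perpMap B F) 2))
      (haarPF (pred_le_succ k) hkd) ∧
    |∫ F : PF d (k - 1) (k + 1), Real.log (sv (perpMap B F) 1 / sv (perpMap B F) 2)
        ∂(haarPF (pred_le_succ k) hkd) - Real.log (sv (lin B) k / sv (lin B) (k + 1))| ≤ C

end Miniflag

end

/-!
*Entropy.* If the push-forwards of a fixed probability measure `ν` under a random map all have
density at most `c`, possibly depending on the map, with respect to one probability measure, then
`Φ(ν)` is at most the mean of `log c`: comparing with the mean push-forward instead of the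
dominating measure only decreases the mean divergence. For `ν` take the law of the line through a
uniform random point of the unit disc of `V_{k+1} ⊖ V_{k-1}`. If a plane map has singular values
`s₁ ≥ s₂`, then rescaled by `s₁⁻¹` it maps the disc into the disc and contracts area by `s₂ / s₁`,
so the push-forward of `ν` has density at most `s₁ / s₂` with respect to the uniform law on the
target miniflag. Averaging over the random matrix and over the flags, and exchanging the two
integrals, leaves the mean logarithmic gap on a random flag, which the gap constant compares with
that of the matrix.

*Gap constants.* Write `G n` for the Gram determinant of the images under `B` of the first `n`
columns of a Haar distributed orthogonal matrix. With `V_{k-1} ⊂ V_{k+1}` spanned by the first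
`k - 1` and `k + 1` columns, `s₁ s₂` on `V_{k+1} ⊖ V_{k-1}` is the square root of
`G (k + 1) / G (k - 1)`, while `s₁ ^ 2` lies between `G k / G (k - 1)` and its maximum over all
choices of the `k`-th vector. By Cauchy–Binet, `G n` lies between `(s₁ ⋯ sₙ) ^ 2` for `B`
and the same product times the square of the minor of the orthogonal matrix with respect to the
right singular vectors of `B`. The error is thus bounded by logarithms of minors, whose means do
not depend on `B`.

*Integrability.* For a Gaussian matrix `𝔼 |det| ^ (-1/2)` is finite, one column at a time. By
Gram–Schmidt a Gaussian frame is the product of an orthonormal frame and a matrix with nonzero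
determinant; averaging over rotations of the frame bounds the corresponding moment of the Haar
minors, hence that of their logarithms.
-/

noncomputable section

namespace Miniflag

/-! ### Entropy of a family of measures with bounded densities -/

section MeanDivergence

variable {Ω Y : Type*} [MeasurableSpace Ω] [MeasurableSpace Y]

theorem klDiv_le_log_of_le_smul {ρ m : Measure Y} [IsProbabilityMeasure ρ]
    [IsProbabilityMeasure m] {c : ℝ} (h : ρ ≤ ENNReal.ofReal c • m) :
    klDiv ρ m ≤ ENNReal.ofReal (Real.log c) := by
  have hac : ρ ≪ m := (Measure.absolutelyContinuous_of_le h).trans Measure.smul_absolutelyContinuous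
  have hle : ∀ᵐ y ∂m, ρ.rnDeriv m y ≤ ENNReal.ofReal c := by
    refine ae_le_of_forall_setLIntegral_le_of_sigmaFinite (by fun_prop) fun s _ _ => ?_
    rw [Measure.setLIntegral_rnDeriv hac, setLIntegral_const]
    exact h s
  have hc : 0 < c := by
    by_contra! hc
    have := h Set.univ
    simp [ENNReal.ofReal_of_nonpos hc] at this
  have hle' : ∀ᵐ y ∂m, (ρ.rnDeriv m y).toReal ≤ c := by
    filter_upwards [hle] with y hy using ENNReal.toReal_le_of_le_ofReal hc.le hy
  obtain ⟨M, hM⟩ := (isCompact_Icc (a := (0 : ℝ)) (b := c)).exists_bound_of_continuousOn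
    continuous_klFun.continuousOn
  have hint : Integrable (llr ρ m) ρ := by
    rw [← integrable_klFun_rnDeriv_iff hac]
    refine .of_bound (Measurable.aestronglyMeasurable (by fun_prop)) M ?_
    filter_upwards [hle'] with y hy using hM _ ⟨ENNReal.toReal_nonneg, hy⟩
  rw [klDiv_of_ac_of_integrable hac hint]
  simp only [probReal_univ, add_sub_cancel_right]
  refine ENNReal.ofReal_le_ofReal ((integral_mono_ae hint (integrable_const (Real.log c)) ?_).trans
    (by simp))
  filter_upwards [hac.ae_le hle', Measure.rnDeriv_pos hac,
    hac.ae_le (Measure.rnDeriv_lt_top ρ m)] with y hy hpos hfin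
  exact Real.log_le_log (ENNReal.toReal_pos hpos.ne' hfin.ne) hy

variable [MeasurableSpace.CountableOrCountablyGenerated Ω Y]

theorem rnDeriv_compProd_right {μ : Measure Ω} [IsFiniteMeasure μ] {κ ξ : Kernel Ω Y}
    [IsFiniteKernel κ] [IsFiniteKernel ξ] (h : ∀ᵐ ω ∂μ, κ ω ≪ ξ ω) :
    (μ ⊗ₘ κ).rnDeriv (μ ⊗ₘ ξ) =ᵐ[μ ⊗ₘ ξ] fun p => κ.rnDeriv ξ p.1 p.2 := by
  have hmeas : Measurable fun p : Ω × Y => κ.rnDeriv ξ p.1 p.2 := Kernel.measurable_rnDeriv κ ξ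
  have hdens : μ ⊗ₘ κ = (μ ⊗ₘ ξ).withDensity fun p => κ.rnDeriv ξ p.1 p.2 := by
    ext s hs
    rw [withDensity_apply _ hs, ← lintegral_indicator hs,
      Measure.lintegral_compProd (hmeas.indicator hs), Measure.compProd_apply hs]
    refine lintegral_congr_ae ?_
    filter_upwards [h] with ω hω
    calc κ ω (Prod.mk ω ⁻¹' s) = ∫⁻ y in Prod.mk ω ⁻¹' s, κ.rnDeriv ξ ω y ∂ξ ω := by
          rw [← Kernel.withDensity_apply' _ hmeas, Kernel.withDensity_rnDeriv_eq hω]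
      _ = ∫⁻ y, s.indicator (fun p => κ.rnDeriv ξ p.1 p.2) (ω, y) ∂ξ ω :=
          (lintegral_indicator (measurable_prodMk_left hs) _).symm
  rw [hdens]
  exact Measure.rnDeriv_withDensity _ hmeas

theorem klDiv_compProd_right (μ : Measure Ω) [IsFiniteMeasure μ] {κ ξ : Kernel Ω Y}
    [IsFiniteKernel κ] [IsFiniteKernel ξ] (h : ∀ᵐ ω ∂μ, κ ω ≪ ξ ω) :
    klDiv (μ ⊗ₘ κ) (μ ⊗ₘ ξ) = ∫⁻ ω, klDiv (κ ω) (ξ ω) ∂μ := by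
  have hmeas : Measurable fun p : Ω × Y => κ.rnDeriv ξ p.1 p.2 := Kernel.measurable_rnDeriv κ ξ
  calc klDiv (μ ⊗ₘ κ) (μ ⊗ₘ ξ)
      = ∫⁻ p, ENNReal.ofReal (klFun (κ.rnDeriv ξ p.1 p.2).toReal) ∂(μ ⊗ₘ ξ) := by
        rw [klDiv_eq_lintegral_klFun_of_ac (Measure.absolutelyContinuous_compProd_right_iff.mpr h)]
        refine lintegral_congr_ae ?_
        filter_upwards [rnDeriv_compProd_right h] with p hp using by rw [hp]
    _ = ∫⁻ ω, ∫⁻ y, ENNReal.ofReal (klFun (κ.rnDeriv ξ ω y).toReal) ∂ξ ω ∂μ :=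
        Measure.lintegral_compProd
          (measurable_klFun.comp hmeas.ennreal_toReal).ennreal_ofReal
    _ = ∫⁻ ω, klDiv (κ ω) (ξ ω) ∂μ := by
        refine lintegral_congr_ae ?_
        filter_upwards [h] with ω hω
        rw [klDiv_eq_lintegral_klFun_of_ac hω]
        refine lintegral_congr_ae ?_
        filter_upwards [Kernel.rnDeriv_eq_rnDeriv_measure (κ := κ) (η := ξ) (a := ω)] with y hy
        rw [hy]

variable [StandardBorelSpace Ω] [Nonempty Ω]

/-- Both sides are divergences of the joint law from a product law; disintegrating over `Y` instead
of `Ω`, the chain rule shows that they differ by `klDiv (κ ∘ₘ η) m`. -/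
theorem lintegral_klDiv_comp_le {η : Measure Ω} [IsProbabilityMeasure η] {m : Measure Y}
    [IsProbabilityMeasure m] {κ : Kernel Ω Y} [IsMarkovKernel κ] (h : ∀ᵐ ω ∂η, κ ω ≪ m) :
    ∫⁻ ω, klDiv (κ ω) (κ ∘ₘ η) ∂η ≤ ∫⁻ ω, klDiv (κ ω) m ∂η := by
  have hswap (q : Measure Y) [IsProbabilityMeasure q] :
      (q ⊗ₘ Kernel.const Y η).map Prod.swap = η ⊗ₘ Kernel.const Ω q := by
    rw [Measure.compProd_const, Measure.compProd_const, Measure.prod_swap]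
  have hpost : ((κ ∘ₘ η) ⊗ₘ κ†η).map Prod.swap = η ⊗ₘ κ := by
    rw [← Measure.swap_comp, swap_compProd_posterior]
  calc ∫⁻ ω, klDiv (κ ω) (κ ∘ₘ η) ∂η
      = klDiv (η ⊗ₘ κ) (η ⊗ₘ Kernel.const Ω (κ ∘ₘ η)) := by
        rw [klDiv_compProd_right η]
        · simp only [Kernel.const_apply]
        · exact Kernel.absolutelyContinuous_comp_of_absolutelyContinuous h
    _ ≤ klDiv ((κ ∘ₘ η) ⊗ₘ κ†η) ((κ ∘ₘ η) ⊗ₘ Kernel.const Y η) := by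
        rw [← hpost, ← hswap]
        exact klDiv_map_le _ _ measurable_swap
    _ ≤ klDiv ((κ ∘ₘ η) ⊗ₘ κ†η) (m ⊗ₘ Kernel.const Y η) := by
        rw [klDiv_compProd_eq_add _ m]
        exact le_add_self
    _ ≤ klDiv (η ⊗ₘ κ) (η ⊗ₘ Kernel.const Ω m) := by
        rw [compProd_posterior_eq_map_swap, Measure.compProd_const, ← Measure.prod_swap,
          ← Measure.compProd_const]
        exact klDiv_map_le _ _ measurable_swap
    _ = ∫⁻ ω, klDiv (κ ω) m ∂η := by
        rw [klDiv_compProd_right η (ξ := Kernel.const Ω m) h]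
        simp only [Kernel.const_apply]

end MeanDivergence

/-! ### Continuity of the action on subspaces -/

section Projection

variable {E : Type*} [NormedAddCommGroup E] [InnerProductSpace ℝ E] [FiniteDimensional ℝ E]

theorem isUnit_add_star_sub_one {Q : E →L[ℝ] E} (hQ : IsIdempotentElem Q) :
    IsUnit (Q + star Q - 1) := by
  have hstar : star Q * star Q = star Q := by rw [← star_mul, hQ.eq]
  have hsq : star (Q + star Q - 1) * (Q + star Q - 1) = 1 + star (Q - star Q) * (Q - star Q) := by
    simp only [star_sub, star_add, star_star, star_one, mul_add, add_mul, mul_sub, sub_mul,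
      one_mul, mul_one, hQ.eq, hstar]
    abel
  have hinj : Function.Injective (Q + star Q - 1 : E →L[ℝ] E) := by
    rw [injective_iff_map_eq_zero]
    intro x hx
    have h0 : (star (Q + star Q - 1) * (Q + star Q - 1)) x = 0 := by
      rw [mul_apply_eq_comp, hx, map_zero]
    have h := congrArg (fun y => inner ℝ y x) (hsq ▸ h0)
    simp only [FunLike.coe_add, Pi.add_apply, mul_apply_eq_comp, one_apply_eq_self,
      inner_add_left, ContinuousLinearMap.star_eq_adjoint, ContinuousLinearMap.adjoint_inner_left,
      real_inner_self_eq_norm_sq, inner_zero_left] at h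
    have hxx : ‖x‖ ^ 2 = 0 :=
      le_antisymm (by linarith [sq_nonneg ‖(Q - Q.adjoint) x‖]) (by positivity)
    simpa using hxx
  rw [ContinuousLinearMap.isUnit_iff_bijective]
  exact ⟨hinj, LinearMap.injective_iff_surjective.mp hinj⟩

/-- The Kerzman–Stein formula for the orthogonal projection onto the range of an idempotent. -/
theorem starProjection_range {Q : E →L[ℝ] E} (hQ : IsIdempotentElem Q) :
    Q.range.starProjection = Q * Ring.inverse (Q + star Q - 1) := by
  set P := Q.range.starProjection with hP
  have hPQ : P * Q = Q := by
    ext x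
    exact Submodule.starProjection_eq_self_iff.mpr ⟨x, rfl⟩
  have hQP : Q * P = P := by
    ext x
    obtain ⟨y, hy⟩ := Q.range.starProjection_apply_mem x
    rw [mul_apply_eq_comp, hP, ← hy]
    exact DFunLike.congr_fun hQ.eq y
  have hPstar : star P = P := (isSelfAdjoint_starProjection Q.range).star_eq
  have hPQstar : P * star Q = P := by rw [← hPstar, ← star_mul, hQP]
  have hmul : P * (Q + star Q - 1) = Q := by rw [mul_sub, mul_add, hPQ, hPQstar]; simp
  calc P = P * (Q + star Q - 1) * Ring.inverse (Q + star Q - 1) :=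
        (Ring.mul_inverse_cancel_right _ _ (isUnit_add_star_sub_one hQ)).symm
    _ = Q * Ring.inverse (Q + star Q - 1) := by rw [hmul]

theorem continuous_starProjection_range {X : Type*} [TopologicalSpace X] {Q : X → E →L[ℝ] E}
    (hQ : Continuous Q) (h : ∀ x, IsIdempotentElem (Q x)) :
    Continuous fun x => (Q x).range.starProjection := by
  simp_rw [fun x => starProjection_range (h x)]
  refine hQ.mul (continuous_iff_continuousAt.mpr fun x => ?_)
  obtain ⟨u, hu⟩ := isUnit_add_star_sub_one (h x)
  exact ContinuousAt.comp (g := Ring.inverse) (hu ▸ NormedRing.inverse_continuousAt u)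
    ((hQ.add hQ.star).sub continuous_const).continuousAt

theorem starProjection_inf_orthogonal {U V : Submodule ℝ E} (h : U ≤ V) :
    (V ⊓ Uᗮ).starProjection = V.starProjection - U.starProjection := by
  ext x
  refine Submodule.eq_starProjection_of_mem_of_inner_eq_zero (Submodule.mem_inf.mpr ⟨?_, ?_⟩) ?_
  · exact V.sub_mem (V.starProjection_apply_mem x) (h (U.starProjection_apply_mem x))
  · rw [Submodule.mem_orthogonal']
    intro u hu
    have hV := V.starProjection_inner_eq_zero x u (h hu)
    have hU := U.starProjection_inner_eq_zero x u hu
    simp only [FunLike.coe_sub, Pi.sub_apply, inner_sub_left] at *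
    linarith
  · intro w hw
    have hV := V.starProjection_inner_eq_zero x w hw.1
    have hU := Submodule.inner_right_of_mem_orthogonal (U.starProjection_apply_mem x) hw.2
    simp only [FunLike.coe_sub, Pi.sub_apply, inner_sub_left] at *
    linarith

end Projection

/-- The operator of multiplication by an invertible matrix, as an element of the normed algebra of
continuous linear maps. -/
def clm {d : ℕ} (A : GL (Fin d) ℝ) : EuclideanSpace ℝ (Fin d) →L[ℝ] EuclideanSpace ℝ (Fin d) :=
  Matrix.toEuclideanCLM (n := Fin d) (𝕜 := ℝ) A

theorem continuous_clm (d : ℕ) : Continuous (clm (d := d)) :=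
  (LinearMap.continuous_of_finiteDimensional
    (Matrix.toEuclideanCLM (n := Fin d) (𝕜 := ℝ)).toAlgEquiv.toLinearMap).comp Units.continuous_val

theorem clm_inv_mul_clm {d : ℕ} (A : GL (Fin d) ℝ) : clm A⁻¹ * clm A = 1 := by
  rw [clm, clm, ← map_mul, ← Units.val_mul, inv_mul_cancel, Units.val_one, map_one]

theorem continuous_starProjection_map {d : ℕ} {X : Type*} [TopologicalSpace X]
    {V : X → Submodule ℝ (EuclideanSpace ℝ (Fin d))}
    (hV : Continuous fun x => (V x).starProjection) :
    Continuous fun p : GL (Fin d) ℝ × X => ((V p.2).map (lin p.1)).starProjection := by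
  let Q (p : GL (Fin d) ℝ × X) := clm p.1 * (V p.2).starProjection * clm p.1⁻¹
  have hidem (p) : IsIdempotentElem (Q p) := by
    have h : Q p * Q p = clm p.1 * (V p.2).starProjection * (clm p.1⁻¹ * clm p.1) *
      (V p.2).starProjection * clm p.1⁻¹ := by simp only [Q, mul_assoc]
    rw [IsIdempotentElem, h, clm_inv_mul_clm, mul_one, mul_assoc (clm p.1),
      (V p.2).isIdempotentElem_starProjection.eq]
  have hrange (p) : (V p.2).map (lin p.1) = (Q p).range := by
    have hsurj : (clm p.1⁻¹).range = ⊤ := LinearMap.range_eq_top.mpr fun x =>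
      ⟨clm p.1 x, DFunLike.congr_fun (clm_inv_mul_clm p.1) x⟩
    change _ = LinearMap.range ((clm p.1).toLinearMap ∘ₗ (V p.2).starProjection.toLinearMap ∘ₗ
      (clm p.1⁻¹).toLinearMap)
    rw [LinearMap.range_comp, LinearMap.range_comp, hsurj, Submodule.map_top,
      Submodule.range_starProjection]
    rfl
  simp_rw [hrange]
  refine continuous_starProjection_range (Continuous.mul (Continuous.mul ?_ ?_) ?_) hidem
  · exact (continuous_clm d).comp continuous_fst
  · exact hV.comp continuous_snd
  · exact (continuous_clm d).comp continuous_fst.inv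

theorem Gr.continuous_starProjection {d k : ℕ} :
    Continuous fun V : Gr d k => V.space.starProjection :=
  continuous_induced_dom

theorem PF.continuous_starProjection {d i j : ℕ} :
    Continuous fun F : PF d i j => (F.lo.starProjection, F.hi.starProjection) :=
  continuous_induced_dom

theorem Gr.continuous_act {d k : ℕ} :
    Continuous fun p : GL (Fin d) ℝ × Gr d k => Gr.act p.1 p.2 :=
  continuous_induced_rng.mpr (continuous_starProjection_map Gr.continuous_starProjection)

theorem PF.continuous_act {d i j : ℕ} :
    Continuous fun p : GL (Fin d) ℝ × PF d i j => PF.act p.1 p.2 :=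
  continuous_induced_rng.mpr
    ((continuous_starProjection_map PF.continuous_starProjection.fst).prodMk
      (continuous_starProjection_map PF.continuous_starProjection.snd))

instance (d k : ℕ) : SecondCountableTopology (Gr d k) :=
  Topology.IsInducing.secondCountableTopology (f := fun V : Gr d k => V.space.starProjection) ⟨rfl⟩

instance (d i j : ℕ) : SecondCountableTopology (PF d i j) :=
  Topology.IsInducing.secondCountableTopology
    (f := fun F : PF d i j => (F.lo.starProjection, F.hi.starProjection)) ⟨rfl⟩

instance (d i j : ℕ) : T2Space (PF d i j) := by
  refine T2Space.of_injective_continuous (fun F G h => ?_) PF.continuous_starProjection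
  rw [Prod.mk.injEq, Submodule.starProjection_inj, Submodule.starProjection_inj] at h
  exact PF.ext h.1 h.2

theorem measurable_act_right {d i j : ℕ} (F : PF d i j) :
    Measurable fun A : GL (Fin d) ℝ => PF.act A F :=
  (PF.continuous_act.comp (continuous_id.prodMk continuous_const)).measurable

theorem continuous_toUnits (d : ℕ) :
    Continuous fun g : Matrix.orthogonalGroup (Fin d) ℝ => (Unitary.toUnits g : GL (Fin d) ℝ) :=
  Units.continuous_iff.mpr ⟨continuous_subtype_val, continuous_subtype_val.star⟩

theorem measurable_orbit {d i j : ℕ} (F : PF d i j) :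
    Measurable fun g : Matrix.orthogonalGroup (Fin d) ℝ => PF.act (Unitary.toUnits g) F :=
  (measurable_act_right F).comp (continuous_toUnits d).measurable

instance {d i j : ℕ} (hij : i ≤ j) (hjd : j ≤ d) : IsProbabilityMeasure (haarPF hij hjd) := by
  have : IsProbabilityMeasure (Measure.haarMeasure
      (⊤ : TopologicalSpace.PositiveCompacts (Matrix.orthogonalGroup (Fin d) ℝ))) :=
    ⟨Measure.haarMeasure_self⟩
  exact Measure.isProbabilityMeasure_map (measurable_orbit _).aemeasurable

theorem continuous_perpMap {d i j : ℕ} :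
    Continuous fun p : GL (Fin d) ℝ × PF d i j => (perpMap p.1 p.2).toContinuousLinearMap := by
  have h (p : GL (Fin d) ℝ × PF d i j) : (perpMap p.1 p.2).toContinuousLinearMap =
      ((PF.act p.1 p.2).hi.starProjection - (PF.act p.1 p.2).lo.starProjection) * clm p.1 *
        (p.2.hi.starProjection - p.2.lo.starProjection) := by
    rw [← starProjection_inf_orthogonal (PF.act p.1 p.2).lo_le_hi,
      ← starProjection_inf_orthogonal p.2.lo_le_hi]
    rfl
  simp_rw [h]
  have hproj : Continuous fun F : PF d i j => F.hi.starProjection - F.lo.starProjection :=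
    PF.continuous_starProjection.snd.sub PF.continuous_starProjection.fst
  exact ((hproj.comp PF.continuous_act).mul ((continuous_clm d).comp continuous_fst)).mul
    (hproj.comp continuous_snd)

/-! ### Singular values -/

section SingularValues

variable {d : ℕ} (T : EuclideanSpace ℝ (Fin d) →ₗ[ℝ] EuclideanSpace ℝ (Fin d))

theorem sv_nonneg (k : ℕ) : 0 ≤ sv T k := T.singularValues_nonneg _

theorem sv_antitone : Antitone (sv T) := fun _ _ h =>
  T.singularValues_antitone (Nat.sub_le_sub_right h 1)

theorem sv_lin_pos (A : GL (Fin d) ℝ) {k : ℕ} (hk : 1 ≤ k) (hkd : k ≤ d) : 0 < sv (lin A) k :=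
  (lin A).injective_iff_forall_lt_finrank_singularValues_pos.mp (lin_injective A) _
    (by rw [finrank_euclideanSpace_fin]; omega)

/-- An orthonormal basis of right singular vectors, ordered by decreasing singular values. -/
def svBasis : OrthonormalBasis (Fin d) ℝ (EuclideanSpace ℝ (Fin d)) :=
  T.isSymmetric_adjoint_comp_self.eigenvectorBasis finrank_euclideanSpace_fin

theorem adjoint_apply_svBasis (i : Fin d) :
    T.adjoint (T (svBasis T i)) = sv T (i + 1) ^ 2 • svBasis T i := by
  have h := T.isSymmetric_adjoint_comp_self.apply_eigenvectorBasis finrank_euclideanSpace_fin i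
  rw [← LinearMap.sq_singularValues_fin T finrank_euclideanSpace_fin i] at h
  exact h

theorem inner_map_svBasis (x : EuclideanSpace ℝ (Fin d)) (i : Fin d) :
    inner ℝ (T x) (T (svBasis T i)) = sv T (i + 1) ^ 2 * inner ℝ x (svBasis T i) := by
  rw [← LinearMap.adjoint_inner_right, adjoint_apply_svBasis, inner_smul_right]

theorem inner_map_map (x y : EuclideanSpace ℝ (Fin d)) :
    inner ℝ (T x) (T y) =
      ∑ i : Fin d, sv T (i + 1) ^ 2 * inner ℝ x (svBasis T i) * inner ℝ (svBasis T i) y := by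
  conv_lhs => rw [← (svBasis T).sum_repr' y, map_sum, inner_sum]
  refine Finset.sum_congr rfl fun i _ => ?_
  rw [map_smul, inner_smul_right, inner_map_svBasis, mul_comm]

theorem norm_map_svBasis (i : Fin d) : ‖T (svBasis T i)‖ = sv T (i + 1) := by
  rw [← sq_eq_sq₀ (norm_nonneg _) (sv_nonneg T _), ← real_inner_self_eq_norm_sq,
    inner_map_svBasis, real_inner_self_eq_norm_sq, (svBasis T).norm_eq_one, one_pow, mul_one]

theorem norm_map_le (x : EuclideanSpace ℝ (Fin d)) : ‖T x‖ ≤ sv T 1 * ‖x‖ := by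
  refine le_of_sq_le_sq ?_ (mul_nonneg (sv_nonneg T 1) (norm_nonneg x))
  rw [← real_inner_self_eq_norm_sq, inner_map_map, mul_pow, ← (svBasis T).sum_sq_inner_right x,
    Finset.mul_sum]
  refine Finset.sum_le_sum fun i _ => ?_
  rw [real_inner_comm x, mul_assoc, ← sq]
  gcongr
  · exact sv_nonneg T _
  · exact sv_antitone T (by omega)

theorem opNorm_eq_sv_one (hd : 0 < d) : ‖T.toContinuousLinearMap‖ = sv T 1 := by
  refine le_antisymm (ContinuousLinearMap.opNorm_le_bound _ (sv_nonneg T 1) (norm_map_le T)) ?_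
  have h := T.toContinuousLinearMap.le_opNorm (svBasis T ⟨0, hd⟩)
  rwa [(svBasis T).norm_eq_one, mul_one, LinearMap.coe_toContinuousLinearMap', norm_map_svBasis]
    at h

theorem sum_norm_map_sq_eq_sum_sv_sq {ι : Type*} [Fintype ι]
    (b : OrthonormalBasis ι ℝ (EuclideanSpace ℝ (Fin d))) :
    ∑ i, ‖T (b i)‖ ^ 2 = ∑ i ∈ Finset.range d, sv T (i + 1) ^ 2 := by
  rw [← Fin.sum_univ_eq_sum_range fun i => sv T (i + 1) ^ 2]
  simp_rw [← real_inner_self_eq_norm_sq, inner_map_map]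
  rw [Finset.sum_comm]
  refine Finset.sum_congr rfl fun j _ => ?_
  simp_rw [mul_assoc, fun i => real_inner_comm (svBasis T j) (b i), ← sq]
  rw [← Finset.mul_sum, b.sum_sq_inner_left, (svBasis T).norm_eq_one, one_pow, mul_one]

theorem sum_sv_sq_of_finrank_range_le {n : ℕ} (hn : n ≤ d) (hT : finrank ℝ T.range ≤ n) :
    ∑ i ∈ Finset.range d, sv T (i + 1) ^ 2 = ∑ i ∈ Finset.range n, sv T (i + 1) ^ 2 := by
  refine (Finset.sum_subset (Finset.range_mono hn) fun i _ hi => ?_).symm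
  have h : sv T (i + 1) = 0 := T.singularValues_eq_zero_iff_le_finrank_range.mpr
    (hT.trans (not_lt.mp (Finset.mem_range.not.mp hi)))
  rw [h, zero_pow two_ne_zero]

theorem measurable_sv_one_div_sv_two {X : Type*} [MeasurableSpace X] [TopologicalSpace X]
    [OpensMeasurableSpace X] {S : X → EuclideanSpace ℝ (Fin d) →ₗ[ℝ] EuclideanSpace ℝ (Fin d)}
    (hS : Continuous fun x => (S x).toContinuousLinearMap) (hd : 2 ≤ d)
    (hrank : ∀ x, finrank ℝ (S x).range ≤ 2) : Measurable fun x => sv (S x) 1 / sv (S x) 2 := by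
  let b := EuclideanSpace.basisFun (Fin d) ℝ
  have hone (x) : sv (S x) 1 = ‖(S x).toContinuousLinearMap‖ :=
    (opNorm_eq_sv_one (S x) (by omega)).symm
  have htwo (x) : sv (S x) 2 =
      √(∑ i, ‖(S x).toContinuousLinearMap (b i)‖ ^ 2 - ‖(S x).toContinuousLinearMap‖ ^ 2) := by
    have h := sum_norm_map_sq_eq_sum_sv_sq (S x) b
    rw [sum_sv_sq_of_finrank_range_le (S x) hd (hrank x), Finset.sum_range_succ,
      Finset.sum_range_one] at h
    rw [← hone, LinearMap.coe_toContinuousLinearMap', h, add_sub_cancel_left,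
      Real.sqrt_sq (sv_nonneg _ _)]
  simp_rw [hone, htwo]
  refine hS.norm.measurable.div (Continuous.measurable (Continuous.sqrt ?_))
  exact (continuous_finsetSum _ fun i _ => (hS.clm_apply continuous_const).norm.pow 2).sub
    (hS.norm.pow 2)

section NormDet

variable {T} {V : Submodule ℝ (EuclideanSpace ℝ (Fin d))}

theorem svBasis_mem (hV : Vᗮ ≤ LinearMap.ker T) {i : Fin d} (hi : sv T (i + 1) ≠ 0) :
    svBasis T i ∈ V := by
  rw [← V.orthogonal_orthogonal]
  intro y hy
  have h := inner_map_svBasis T y i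
  rw [hV hy, inner_zero_left] at h
  exact (mul_eq_zero.mp h.symm).resolve_left (pow_ne_zero 2 hi)

theorem gram_map_svBasis {ι : Type*} [DecidableEq ι] {f : ι → Fin d} (hf : Function.Injective f) :
    Matrix.gram ℝ (fun a => T (svBasis T (f a))) = Matrix.diagonal fun a => sv T (f a + 1) ^ 2 := by
  ext a b
  rw [Matrix.gram_apply, inner_map_svBasis, orthonormal_iff_ite.mp (svBasis T).orthonormal,
    Matrix.diagonal_apply]
  by_cases hab : a = b
  · rw [hab, if_pos rfl, if_pos rfl, mul_one]
  · rw [if_neg (hf.ne hab), if_neg hab, mul_zero]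

theorem normDet_domRestrict_eq_prod_sv (hV : Vᗮ ≤ LinearMap.ker T) :
    (T.domRestrict V).normDet = ∏ i ∈ Finset.range (finrank ℝ V), sv T (i + 1) := by
  by_cases! hzero : ∃ i < finrank ℝ V, sv T (i + 1) = 0
  · obtain ⟨i, hi, hi0⟩ := hzero
    rw [Finset.prod_eq_zero (f := fun i => sv T (i + 1)) (Finset.mem_range.mpr hi) hi0,
      LinearMap.normDet_eq_zero_iff_rank_range_ne]
    have hrange : (T.domRestrict V).range ≤ T.range := LinearMap.range_comp_le_range _ _
    exact ((Submodule.finrank_mono hrange).trans_lt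
      ((T.singularValues_eq_zero_iff_le_finrank_range.mp hi0).trans_lt hi)).ne
  · have hVd : finrank ℝ V ≤ d := V.finrank_le.trans_eq finrank_euclideanSpace_fin
    have horth : Orthonormal ℝ fun i : Fin (finrank ℝ V) => (⟨svBasis T (Fin.castLE hVd i),
        svBasis_mem hV (hzero i i.2)⟩ : V) :=
      ((svBasis T).orthonormal.comp _ (Fin.castLE_injective hVd)).codRestrict V _
    let b : OrthonormalBasis (Fin (finrank ℝ V)) ℝ V :=
      OrthonormalBasis.mk horth (horth.linearIndependent.span_eq_top_of_card_eq_finrank'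
        (Fintype.card_fin _)).ge
    rw [← sq_eq_sq₀ (LinearMap.normDet_nonneg _) (Finset.prod_nonneg fun i _ => sv_nonneg T _),
      ← Finset.prod_pow, ← Fin.prod_univ_eq_prod_range fun i => sv T (i + 1) ^ 2]
    have h := (T.domRestrict V).normDet_sq_eq_det_gram b
    simp only [b, OrthonormalBasis.coe_mk, LinearMap.domRestrict_apply,
      gram_map_svBasis (Fin.castLE_injective hVd), Matrix.det_diagonal] at h
    exact h

end NormDet

end SingularValues

/-! ### Gram determinants -/

section Gram

variable {E : Type*} [NormedAddCommGroup E] [InnerProductSpace ℝ E]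

theorem gram_sum_smul {ι κ : Type*} [Fintype ι] (u : ι → E) (X : Matrix ι κ ℝ) :
    Matrix.gram ℝ (fun j => ∑ i, X i j • u i) = X.transpose * Matrix.gram ℝ u * X := by
  ext a b
  simp only [Matrix.gram_apply, Matrix.mul_apply, Matrix.transpose_apply, sum_inner, inner_sum,
    inner_smul_left, inner_smul_right, conj_trivial, Finset.sum_mul]
  refine Finset.sum_congr rfl fun i _ => ?_
  rw [Finset.mul_sum]
  exact Finset.sum_congr rfl fun j _ => by ring

theorem gram_sumElim_of_orthogonal {ι κ : Type*} {v : ι → E} {w : κ → E}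
    (h : ∀ i j, inner ℝ (v i) (w j) = 0) :
    Matrix.gram ℝ (Sum.elim v w) =
      Matrix.fromBlocks (Matrix.gram ℝ v) 0 0 (Matrix.gram ℝ w) := by
  ext (i | i) (j | j)
  · rfl
  · exact h i j
  · exact (real_inner_comm _ _).trans (h j i)
  · rfl

theorem det_gram_sumElim {ι κ : Type*} [Fintype ι] [Fintype κ] [DecidableEq ι] [DecidableEq κ]
    (v : ι → E) (w : κ → E) [(Submodule.span ℝ (Set.range v)).HasOrthogonalProjection] :
    (Matrix.gram ℝ (Sum.elim v w)).det = (Matrix.gram ℝ v).det *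
      (Matrix.gram ℝ fun j => w j - (Submodule.span ℝ (Set.range v)).starProjection (w j)).det := by
  set P := (Submodule.span ℝ (Set.range v)).starProjection
  have hex (j : κ) : ∃ c : ι → ℝ, ∑ i, c i • v i = P (w j) :=
    (Submodule.mem_span_range_iff_exists_fun ℝ).mp (Submodule.starProjection_apply_mem _ _)
  choose c hc using hex
  let u : ι ⊕ κ → E := Sum.elim v fun j => w j - P (w j)
  let X : Matrix (ι ⊕ κ) (ι ⊕ κ) ℝ := Matrix.fromBlocks 1 (Matrix.of fun i j => c j i) 0 1
  have hXu : Sum.elim v w = fun j => ∑ i, X i j • u i := by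
    funext j
    rcases j with j | j
    · simp [X, u, Matrix.one_apply]
    · simp [X, u, Matrix.one_apply, hc]
  have horth (i j) : inner ℝ (v i) (w j - P (w j)) = 0 :=
    (real_inner_comm _ _).trans
      (Submodule.starProjection_inner_eq_zero _ _ (Submodule.subset_span ⟨i, rfl⟩))
  rw [hXu, gram_sum_smul, Matrix.det_mul, Matrix.det_mul, Matrix.det_transpose,
    gram_sumElim_of_orthogonal horth, Matrix.det_fromBlocks_zero₂₁, Matrix.det_fromBlocks_zero₂₁]
  simp

end Gram

section CauchyBinet

variable {ι n : Type*} [Fintype ι] [DecidableEq ι] [Fintype n] [DecidableEq n]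

theorem det_transpose_mul_diagonal_mul (N : Matrix n ι ℝ) (D : n → ℝ) :
    (N.transpose * Matrix.diagonal D * N).det =
      ∑ f : ι → n, (∏ a, D (f a) * N (f a) a) * (N.submatrix f id).det := by
  have hrow : N.transpose * Matrix.diagonal D * N =
      Matrix.of fun a => ∑ x, (D x * N x a) • N x := by
    ext a b
    rw [Matrix.mul_apply]
    simp only [Matrix.mul_diagonal, Matrix.transpose_apply, Matrix.of_apply,
      Finset.sum_apply, Pi.smul_apply, smul_eq_mul]
    exact Finset.sum_congr rfl fun x _ => by ring
  rw [hrow]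
  refine (Matrix.detRowAlternating.toMultilinearMap.map_sum fun a x =>
    (D x * N x a) • N x).trans (Finset.sum_congr rfl fun f _ => ?_)
  exact Matrix.detRowAlternating.toMultilinearMap.map_smul_univ _ _

/-- The Cauchy–Binet formula; summing over all maps instead of all subsets counts every term
`(card ι)!` times. -/
theorem factorial_mul_det_transpose_mul_diagonal_mul (N : Matrix n ι ℝ) (D : n → ℝ) :
    ((Fintype.card ι).factorial : ℝ) * (N.transpose * Matrix.diagonal D * N).det =
      ∑ f : ι → n, (∏ a, D (f a)) * (N.submatrix f id).det ^ 2 := by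
  have hperm (τ : Equiv.Perm ι) : (N.transpose * Matrix.diagonal D * N).det =
      ∑ f : ι → n, (∏ a, D (f a)) * (N.submatrix f id).det *
        ((Equiv.Perm.sign τ : ℤ) * ∏ a, N (f (τ a)) a) := by
    rw [det_transpose_mul_diagonal_mul, ← (Equiv.arrowCongr τ (Equiv.refl n)).symm.sum_comp]
    refine Finset.sum_congr rfl fun f _ => ?_
    have hf : (Equiv.arrowCongr τ (Equiv.refl n)).symm f = f ∘ τ := rfl
    have hdet : (N.submatrix (f ∘ τ) id).det =
        (Equiv.Perm.sign τ : ℤ) * (N.submatrix f id).det :=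
      Matrix.det_permute τ (N.submatrix f id)
    rw [hf, hdet, Finset.prod_mul_distrib]
    simp only [Function.comp_apply]
    rw [Equiv.prod_comp τ fun a => D (f a)]
    ring
  have hcard : ((Fintype.card ι).factorial : ℝ) * (N.transpose * Matrix.diagonal D * N).det =
      ∑ _τ : Equiv.Perm ι, (N.transpose * Matrix.diagonal D * N).det := by
    rw [Finset.sum_const, Finset.card_univ, Fintype.card_perm, nsmul_eq_mul]
  rw [hcard, Finset.sum_congr rfl fun τ _ => hperm τ, Finset.sum_comm]
  refine Finset.sum_congr rfl fun f _ => ?_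
  rw [← Finset.mul_sum, sq, ← mul_assoc]
  congr 1
  exact (Matrix.det_apply' (N.submatrix f id)).symm

end CauchyBinet

theorem prod_le_prod_range_of_antitone {g : ℕ → ℝ} (hg : Antitone g) (h0 : ∀ i, 0 ≤ g i)
    (S : Finset ℕ) : ∏ i ∈ S, g i ≤ ∏ i ∈ Finset.range S.card, g i := by
  induction S using Finset.induction_on_max with
  | empty => simp
  | insert a s hs ih =>
    have ha : a ∉ s := fun h => lt_irrefl a (hs a h)
    rw [Finset.prod_insert ha, Finset.card_insert_of_notMem ha, Finset.prod_range_succ, mul_comm]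
    refine mul_le_mul ih (hg ?_) (h0 a) (Finset.prod_nonneg fun i _ => h0 i)
    have hsub : s ⊆ Finset.range a := fun x hx => Finset.mem_range.mpr (hs x hx)
    exact (Finset.card_le_card hsub).trans_eq (Finset.card_range a)

section Volume

variable {d : ℕ} (T : EuclideanSpace ℝ (Fin d) →ₗ[ℝ] EuclideanSpace ℝ (Fin d))
  {ι : Type*} [Fintype ι] [DecidableEq ι]

/-- The coordinates of a family of vectors in the basis of right singular vectors of `T`, one
vector per column. -/
def svCoord (u : ι → EuclideanSpace ℝ (Fin d)) : Matrix (Fin d) ι ℝ :=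
  Matrix.of fun i a => inner ℝ (svBasis T i) (u a)

theorem factorial_mul_det_gram_map (u : ι → EuclideanSpace ℝ (Fin d)) :
    ((Fintype.card ι).factorial : ℝ) * (Matrix.gram ℝ fun a => T (u a)).det =
      ∑ f : ι → Fin d, (∏ a, sv T (f a + 1) ^ 2) * ((svCoord T u).submatrix f id).det ^ 2 := by
  rw [← factorial_mul_det_transpose_mul_diagonal_mul (svCoord T u)
    (fun i : Fin d => sv T (i + 1) ^ 2)]
  congr 2
  ext a b
  rw [Matrix.gram_apply, inner_map_map, Matrix.mul_apply]
  refine Finset.sum_congr rfl fun i _ => ?_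
  rw [Matrix.mul_diagonal, Matrix.transpose_apply, svCoord, Matrix.of_apply, Matrix.of_apply,
    real_inner_comm (u a), mul_comm (sv T (i + 1) ^ 2)]

theorem sum_det_svCoord_sq {u : ι → EuclideanSpace ℝ (Fin d)} (hu : Orthonormal ℝ u) :
    ∑ f : ι → Fin d, ((svCoord T u).submatrix f id).det ^ 2 = (Fintype.card ι).factorial := by
  have h := factorial_mul_det_transpose_mul_diagonal_mul (svCoord T u) (fun _ => 1)
  have hgram : (svCoord T u).transpose * svCoord T u = Matrix.gram ℝ u := by
    rw [Matrix.gram_eq_conjTranspose_mul (svBasis T) u,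
      Matrix.conjTranspose_eq_transpose_of_trivial]
    simp only [OrthonormalBasis.repr_apply_apply]
    rfl
  simp only [Finset.prod_const_one, one_mul, Matrix.diagonal_one, Matrix.mul_one] at h
  rw [← h, hgram, Matrix.gram_eq_one_iff_orthonormal.mpr hu, Matrix.det_one, mul_one]

theorem det_gram_map_le {u : ι → EuclideanSpace ℝ (Fin d)} (hu : Orthonormal ℝ u) :
    (Matrix.gram ℝ fun a => T (u a)).det ≤
      ∏ i ∈ Finset.range (Fintype.card ι), sv T (i + 1) ^ 2 := by
  have hpos : (0 : ℝ) < (Fintype.card ι).factorial := by positivity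
  refine le_of_mul_le_mul_left ?_ hpos
  rw [factorial_mul_det_gram_map, ← sum_det_svCoord_sq T hu, Finset.sum_mul]
  refine Finset.sum_le_sum fun f _ => ?_
  rw [mul_comm]
  by_cases hf : Function.Injective f
  · have hf' : Function.Injective fun a => (f a : ℕ) := Fin.val_injective.comp hf
    have hS := prod_le_prod_range_of_antitone (g := fun i => sv T (i + 1) ^ 2)
      (fun i j hij => pow_le_pow_left₀ (sv_nonneg T _) (sv_antitone T (by omega)) 2)
      (fun i => sq_nonneg _) (Finset.univ.image fun a => (f a : ℕ))
    rw [Finset.prod_image hf'.injOn, Finset.card_image_of_injective _ hf', Finset.card_univ] at hS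
    gcongr
  · obtain ⟨a, b, hab, hne⟩ := Function.not_injective_iff.mp hf
    rw [Matrix.det_zero_of_row_eq hne (by ext c; simp [hab])]
    simp

theorem le_factorial_mul_det_gram_map (u : ι → EuclideanSpace ℝ (Fin d)) (f : ι → Fin d) :
    (∏ a, sv T (f a + 1) ^ 2) * ((svCoord T u).submatrix f id).det ^ 2 ≤
      ((Fintype.card ι).factorial : ℝ) * (Matrix.gram ℝ fun a => T (u a)).det := by
  rw [factorial_mul_det_gram_map]
  exact Finset.single_le_sum (f := fun f : ι → Fin d =>
    (∏ a, sv T (f a + 1) ^ 2) * ((svCoord T u).submatrix f id).det ^ 2)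
    (fun f _ => mul_nonneg (Finset.prod_nonneg fun a _ => sq_nonneg _) (sq_nonneg _))
    (Finset.mem_univ f)

end Volume

/-! ### The plane `V_{k+1} ⊖ V_{k-1}` and the miniflag -/

/-- The orthogonal complement `V_j ⊖ V_i` of the smaller member of a partial flag in the larger. -/
abbrev PF.diff {d i j : ℕ} (F : PF d i j) : Submodule ℝ (EuclideanSpace ℝ (Fin d)) :=
  F.hi ⊓ F.loᗮ

section Flag

variable {d i j : ℕ} (B : GL (Fin d) ℝ) (F : PF d i j) {x : EuclideanSpace ℝ (Fin d)}

theorem PF.add_finrank_diff : i + finrank ℝ F.diff = j := by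
  have h := Submodule.finrank_add_inf_finrank_orthogonal F.lo_le_hi
  rwa [F.finrank_lo, F.finrank_hi, inf_comm] at h

theorem PF.eq_zero_of_mem_lo_of_mem_diff (hlo : x ∈ F.lo) (hdiff : x ∈ F.diff) : x = 0 :=
  inner_self_eq_zero.mp (Submodule.inner_right_of_mem_orthogonal (𝕜 := ℝ) hlo hdiff.2)

theorem PF.sub_starProjection_diff_mem_lo (hx : x ∈ F.hi) :
    x - F.diff.starProjection x ∈ F.lo := by
  rw [starProjection_inf_orthogonal F.lo_le_hi, FunLike.coe_sub, Pi.sub_apply,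
    F.hi.starProjection_eq_self_iff.mpr hx, sub_sub_cancel]
  exact F.lo.starProjection_apply_mem x

theorem perpMap_mem_diff : perpMap B F x ∈ (PF.act B F).diff :=
  Submodule.starProjection_apply_mem _ _

theorem perpMap_of_mem_diff (hx : x ∈ F.diff) :
    perpMap B F x = (PF.act B F).diff.starProjection (lin B x) := by
  change (PF.act B F).diff.starProjection (lin B (F.diff.starProjection x)) = _
  rw [F.diff.starProjection_eq_self_iff.mpr hx]

theorem lin_sub_perpMap_mem_lo (hx : x ∈ F.diff) : lin B x - perpMap B F x ∈ (PF.act B F).lo := by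
  rw [perpMap_of_mem_diff B F hx]
  exact (PF.act B F).sub_starProjection_diff_mem_lo (Submodule.mem_map_of_mem hx.1)

theorem eq_zero_of_perpMap_eq_zero (hx : x ∈ F.diff) (h : perpMap B F x = 0) : x = 0 := by
  have hlo := lin_sub_perpMap_mem_lo B F hx
  rw [h, sub_zero] at hlo
  obtain ⟨y, hy, hyx⟩ := hlo
  exact F.eq_zero_of_mem_lo_of_mem_diff (lin_injective B hyx ▸ hy) hx

theorem orthogonal_diff_le_ker_perpMap : F.diffᗮ ≤ LinearMap.ker (perpMap B F) := by
  intro x hx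
  have hx0 : F.diff.starProjection x = 0 := F.diff.starProjection_apply_eq_zero_iff.mpr hx
  change (PF.act B F).diff.starProjection (lin B (F.diff.starProjection x)) = 0
  rw [hx0, map_zero, map_zero]

theorem finrank_range_perpMap : finrank ℝ (perpMap B F).range = finrank ℝ F.diff := by
  apply le_antisymm
  · have hle : (perpMap B F).range ≤ (PF.act B F).diff := by
      rintro _ ⟨x, rfl⟩
      exact perpMap_mem_diff B F
    have hF := F.add_finrank_diff
    have hBF := (PF.act B F).add_finrank_diff
    exact (Submodule.finrank_mono hle).trans_eq (by omega)
  · have hinj : Function.Injective ((perpMap B F).domRestrict F.diff) := by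
      rw [injective_iff_map_eq_zero]
      exact fun x hx => Subtype.ext (eq_zero_of_perpMap_eq_zero B F x.2 hx)
    rw [← LinearMap.finrank_range_of_inj hinj]
    exact Submodule.finrank_mono (LinearMap.range_comp_le_range _ _)

theorem sv_perpMap_pos {n : ℕ} (hn : 1 ≤ n) (hij : i + n ≤ j) : 0 < sv (perpMap B F) n := by
  refine (perpMap B F).singularValues_pos_iff_lt_finrank_range.mpr ?_
  have := F.add_finrank_diff
  rw [finrank_range_perpMap]
  omega

theorem normDet_domRestrict_perpMap : ((perpMap B F).domRestrict F.diff).normDet =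
    ∏ n ∈ Finset.range (finrank ℝ F.diff), sv (perpMap B F) (n + 1) :=
  normDet_domRestrict_eq_prod_sv (orthogonal_diff_le_ker_perpMap B F)

end Flag

section Plane

variable {d k : ℕ} (hk : 1 ≤ k) (B : GL (Fin d) ℝ) (F : PF d (k - 1) (k + 1))

include hk in
theorem PF.finrank_diff_eq_two : finrank ℝ F.diff = 2 := by
  have := F.add_finrank_diff
  omega

include hk in
theorem normDet_domRestrict_perpMap_eq_mul : ((perpMap B F).domRestrict F.diff).normDet =
    sv (perpMap B F) 1 * sv (perpMap B F) 2 := by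
  rw [normDet_domRestrict_perpMap, F.finrank_diff_eq_two hk, Finset.prod_range_succ,
    Finset.prod_range_one]

include hk in
theorem measurable_sv_perpMap_div (hkd : k < d) :
    Measurable fun p : GL (Fin d) ℝ × PF d (k - 1) (k + 1) =>
      sv (perpMap p.1 p.2) 1 / sv (perpMap p.1 p.2) 2 :=
  measurable_sv_one_div_sv_two continuous_perpMap (by omega) fun p =>
    ((finrank_range_perpMap p.1 p.2).trans (p.2.finrank_diff_eq_two hk)).le

/-- An orthonormal basis of `V_{k+1} ⊖ V_{k-1}`. -/
def PF.planeBasis : OrthonormalBasis (Fin 2) ℝ F.diff :=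
  (stdOrthonormalBasis ℝ F.diff).reindex (finCongr (F.finrank_diff_eq_two hk))

/-- The parametrization of the plane `V_{k+1} ⊖ V_{k-1}` by `ℝ²`. -/
def PF.planeIso : EuclideanSpace ℝ (Fin 2) →ₗᵢ[ℝ] EuclideanSpace ℝ (Fin d) :=
  F.diff.subtypeₗᵢ.comp (F.planeBasis hk).repr.symm.toLinearIsometry

theorem PF.planeIso_mem_diff (x : EuclideanSpace ℝ (Fin 2)) : F.planeIso hk x ∈ F.diff :=
  ((F.planeBasis hk).repr.symm x).2

theorem PF.planeIso_basisFun (i : Fin 2) :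
    F.planeIso hk (EuclideanSpace.basisFun (Fin 2) ℝ i) = F.planeBasis hk i := by
  simp [PF.planeIso]

/-- The map `B|_{V_{k+1} ⊥ V_{k-1}}` in the coordinates `planeIso` of source and target. -/
def planeMap : EuclideanSpace ℝ (Fin 2) →ₗ[ℝ] EuclideanSpace ℝ (Fin 2) :=
  ((PF.act B F).planeBasis hk).repr.toLinearEquiv.toLinearMap ∘ₗ
    (PF.act B F).diff.orthogonalProjectionOnto.toLinearMap ∘ₗ lin B ∘ₗ (F.planeIso hk).toLinearMap

theorem planeIso_planeMap (x : EuclideanSpace ℝ (Fin 2)) :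
    (PF.act B F).planeIso hk (planeMap hk B F x) = perpMap B F (F.planeIso hk x) := by
  rw [perpMap_of_mem_diff B F (F.planeIso_mem_diff hk x)]
  simp [planeMap, PF.planeIso]

theorem norm_planeMap_le (x : EuclideanSpace ℝ (Fin 2)) :
    ‖planeMap hk B F x‖ ≤ sv (perpMap B F) 1 * ‖x‖ := by
  rw [← ((PF.act B F).planeIso hk).norm_map, planeIso_planeMap, ← (F.planeIso hk).norm_map x]
  exact norm_map_le _ _

theorem abs_det_planeMap :
    |LinearMap.det (planeMap hk B F)| = sv (perpMap B F) 1 * sv (perpMap B F) 2 := by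
  let e := EuclideanSpace.basisFun (Fin 2) ℝ
  have hgram : (Matrix.gram ℝ fun i => planeMap hk B F (e i)) =
      Matrix.gram ℝ fun i => (perpMap B F).domRestrict F.diff (F.planeBasis hk i) := by
    ext i j
    rw [Matrix.gram_apply, Matrix.gram_apply, LinearMap.domRestrict_apply,
      LinearMap.domRestrict_apply, ← PF.planeIso_basisFun, ← PF.planeIso_basisFun,
      ← planeIso_planeMap, ← planeIso_planeMap, LinearIsometry.inner_map_map]
  rw [← Real.norm_eq_abs, ← LinearMap.normDet_eq_norm_det,
    ← normDet_domRestrict_perpMap_eq_mul hk,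
    ← sq_eq_sq₀ (LinearMap.normDet_nonneg _) (LinearMap.normDet_nonneg _)]
  have hplane := (planeMap hk B F).normDet_sq_eq_det_gram e
  have hperp := ((perpMap B F).domRestrict F.diff).normDet_sq_eq_det_gram (F.planeBasis hk)
  exact hplane.trans (hgram ▸ hperp.symm)

theorem planeMap_ne_zero {x : EuclideanSpace ℝ (Fin 2)} (hx : x ≠ 0) : planeMap hk B F x ≠ 0 := by
  intro h
  have h0 : perpMap B F (F.planeIso hk x) = 0 := by rw [← planeIso_planeMap, h, map_zero]
  have := eq_zero_of_perpMap_eq_zero B F (F.planeIso_mem_diff hk x) h0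
  exact hx ((F.planeIso hk).injective (this.trans (map_zero _).symm))

/-- The vector with coordinates `x` in `V_{k+1} ⊖ V_{k-1}`, or a default nonzero vector if
`x = 0`. -/
def PF.direction (x : EuclideanSpace ℝ (Fin 2)) : EuclideanSpace ℝ (Fin d) :=
  open Classical in
  F.planeIso hk (if x = 0 then EuclideanSpace.single 0 1 else x)

theorem PF.direction_of_ne {x : EuclideanSpace ℝ (Fin 2)} (hx : x ≠ 0) :
    F.direction hk x = F.planeIso hk x := by
  rw [PF.direction, if_neg hx]

theorem PF.direction_mem_diff (x : EuclideanSpace ℝ (Fin 2)) : F.direction hk x ∈ F.diff :=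
  F.planeIso_mem_diff hk _

theorem PF.direction_ne_zero (x : EuclideanSpace ℝ (Fin 2)) : F.direction hk x ≠ 0 := by
  rw [PF.direction, ← map_zero (F.planeIso hk)]
  refine (F.planeIso hk).injective.ne ?_
  split_ifs with h
  · simp
  · exact h

theorem PF.measurable_direction : Measurable (F.direction hk) :=
  (F.planeIso hk).continuous.measurable.comp
    (Measurable.ite (measurableSet_singleton 0) measurable_const measurable_id)

/-- The point `V_{k-1} + ℝ x` of the miniflag. -/
def PF.line (x : EuclideanSpace ℝ (Fin 2)) : Gr d k where
  space := F.lo ⊔ Submodule.span ℝ {F.direction hk x}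
  finrank_space := by
    have h := Submodule.finrank_sup_add_finrank_inf_eq F.lo
      (Submodule.span ℝ {F.direction hk x})
    have h0 : F.lo ⊓ Submodule.span ℝ {F.direction hk x} = ⊥ := by
      rw [Submodule.eq_bot_iff]
      rintro y ⟨hlo, hspan⟩
      exact F.eq_zero_of_mem_lo_of_mem_diff hlo
        ((Submodule.span_singleton_le_iff_mem _ _).mpr (F.direction_mem_diff hk x) hspan)
    rw [h0, finrank_bot, finrank_span_singleton (F.direction_ne_zero hk x), F.finrank_lo] at h
    omega

theorem PF.line_mem_fiber (x : EuclideanSpace ℝ (Fin 2)) : F.line hk x ∈ fiber F :=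
  ⟨le_sup_left, sup_le F.lo_le_hi
    ((Submodule.span_singleton_le_iff_mem _ _).mpr (F.direction_mem_diff hk x).1)⟩

theorem starProjection_sup_span_singleton {E : Type*} [NormedAddCommGroup E]
    [InnerProductSpace ℝ E] {U : Submodule ℝ E} {w : E} [U.HasOrthogonalProjection]
    [(U ⊔ Submodule.span ℝ {w}).HasOrthogonalProjection] (hw : w ∈ Uᗮ) (hw0 : w ≠ 0) :
    (U ⊔ Submodule.span ℝ {w}).starProjection =
      U.starProjection + (‖w‖ ^ 2)⁻¹ • InnerProductSpace.rankOne ℝ w w := by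
  ext1 x
  have hval : (U.starProjection + (‖w‖ ^ 2)⁻¹ • InnerProductSpace.rankOne ℝ w w) x =
      U.starProjection x + ((‖w‖ ^ 2)⁻¹ * inner ℝ w x) • w := by
    simp [mul_smul]
  have hUw : inner ℝ (U.starProjection x) w = 0 :=
    Submodule.inner_right_of_mem_orthogonal (U.starProjection_apply_mem x) hw
  rw [hval]
  refine Submodule.eq_starProjection_of_mem_of_inner_eq_zero
    (Submodule.add_mem_sup (U.starProjection_apply_mem x)
      (Submodule.smul_mem _ _ (Submodule.mem_span_singleton_self w))) fun y hy => ?_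
  obtain ⟨u, hu, v, hv, rfl⟩ := Submodule.mem_sup.mp hy
  obtain ⟨c, rfl⟩ := Submodule.mem_span_singleton.mp hv
  have hxu := U.starProjection_inner_eq_zero x u hu
  have hwu : inner ℝ w u = 0 := Submodule.inner_left_of_mem_orthogonal hu hw
  simp only [inner_sub_left] at hxu
  simp only [inner_sub_left, inner_add_left, inner_add_right, inner_smul_left, inner_smul_right,
    hUw, hwu, conj_trivial, real_inner_self_eq_norm_sq, real_inner_comm w x]
  linear_combination hxu - c * inner ℝ w x *
    inv_mul_cancel₀ (pow_ne_zero 2 (norm_ne_zero_iff.mpr hw0))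

theorem PF.measurable_line : Measurable (F.line hk) := by
  have hborel : instMeasurableSpaceGr d k = MeasurableSpace.comap
      (fun V : Gr d k => V.space.starProjection) (borel _) := borel_comap
  rw [hborel]
  refine measurable_comap_iff.mpr ?_
  have hproj (x) : (F.line hk x).space.starProjection = F.lo.starProjection +
      (‖F.direction hk x‖ ^ 2)⁻¹ •
        InnerProductSpace.rankOne ℝ (F.direction hk x) (F.direction hk x) :=
    starProjection_sup_span_singleton (F.direction_mem_diff hk x).2 (F.direction_ne_zero hk x)
  have hrank : Continuous fun w : EuclideanSpace ℝ (Fin d) => InnerProductSpace.rankOne ℝ w w :=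
    (InnerProductSpace.rankOne ℝ).continuous.clm_apply continuous_id
  have hdir := F.measurable_direction hk
  change Measurable fun x => (F.line hk x).space.starProjection
  simp_rw [hproj]
  exact measurable_const.add ((hdir.norm.pow_const 2).inv.smul (hrank.measurable.comp hdir))

theorem sup_span_singleton_eq_of_sub_mem {R M : Type*} [Ring R] [AddCommGroup M] [Module R M]
    {U : Submodule R M} {v w : M} (h : v - w ∈ U) :
    U ⊔ Submodule.span R {v} = U ⊔ Submodule.span R {w} := by
  have hle {v w : M} (h : v - w ∈ U) : U ⊔ Submodule.span R {v} ≤ U ⊔ Submodule.span R {w} := by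
    refine sup_le le_sup_left ((Submodule.span_singleton_le_iff_mem _ _).mpr ?_)
    rw [← sub_add_cancel v w]
    exact Submodule.add_mem_sup h (Submodule.mem_span_singleton_self w)
  exact le_antisymm (hle h) (hle (by rw [← neg_sub]; exact neg_mem h))

theorem act_line {x : EuclideanSpace ℝ (Fin 2)} (hx : x ≠ 0) :
    Gr.act B (F.line hk x) = (PF.act B F).line hk (planeMap hk B F x) := by
  ext1
  change (F.lo ⊔ Submodule.span ℝ {F.direction hk x}).map (lin B) =
    (PF.act B F).lo ⊔ Submodule.span ℝ {(PF.act B F).direction hk (planeMap hk B F x)}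
  rw [F.direction_of_ne hk hx, (PF.act B F).direction_of_ne hk (planeMap_ne_zero hk B F hx),
    planeIso_planeMap, Submodule.map_sup, Submodule.map_span, Set.image_singleton]
  exact sup_span_singleton_eq_of_sub_mem
    (lin_sub_perpMap_mem_lo B F (F.planeIso_mem_diff hk x))

theorem PF.line_smul {r : ℝ} (hr : r ≠ 0) {x : EuclideanSpace ℝ (Fin 2)} (hx : x ≠ 0) :
    F.line hk (r • x) = F.line hk x := by
  ext1
  change F.lo ⊔ Submodule.span ℝ {F.direction hk (r • x)} =
    F.lo ⊔ Submodule.span ℝ {F.direction hk x}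
  rw [F.direction_of_ne hk hx, F.direction_of_ne hk (smul_ne_zero hr hx), map_smul,
    Submodule.span_singleton_smul_eq hr.isUnit]

end Plane

/-! ### The uniform law on a miniflag and its distortion -/

open scoped Pointwise in
theorem cond_ball_preimage_le {E : Type*} [NormedAddCommGroup E] [NormedSpace ℝ E]
    [FiniteDimensional ℝ E] [MeasurableSpace E] [BorelSpace E] (ν : Measure E)
    [ν.IsAddHaarMeasure] {T : E →ₗ[ℝ] E} {s : ℝ} (hs : 0 < s) (hT : LinearMap.det T ≠ 0)
    (hTs : ∀ x, ‖T x‖ ≤ s * ‖x‖) {Z : Set E} (hZ : ∀ y ∈ Z, s⁻¹ • y ∈ Z) :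
    ν[|Metric.ball 0 1] (T ⁻¹' Z) ≤
      ENNReal.ofReal (s ^ finrank ℝ E / |LinearMap.det T|) * ν[|Metric.ball 0 1] Z := by
  have hsub : Metric.ball 0 1 ∩ T ⁻¹' Z ⊆ T ⁻¹' (s • (Metric.ball 0 1 ∩ Z)) := by
    rintro x ⟨hx, hxZ⟩
    rw [Set.mem_preimage, Set.mem_smul_set_iff_inv_smul_mem₀ hs.ne']
    refine ⟨?_, hZ _ hxZ⟩
    rw [mem_ball_zero_iff] at hx ⊢
    rw [norm_smul, norm_inv, Real.norm_of_nonneg hs.le, inv_mul_lt_iff₀ hs]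
    exact (hTs x).trans_lt (by gcongr)
  have h := measure_mono (μ := ν) hsub
  rw [Measure.addHaar_preimage_linearMap _ hT, Measure.addHaar_smul, ← mul_assoc,
    ← ENNReal.ofReal_mul (abs_nonneg _), abs_of_nonneg (pow_nonneg hs.le _), abs_inv,
    inv_mul_eq_div] at h
  rw [cond_apply measurableSet_ball, cond_apply measurableSet_ball, mul_left_comm]
  gcongr

/-- The uniform law on the unit disc. -/
def discLaw : Measure (EuclideanSpace ℝ (Fin 2)) :=
  volume[|Metric.ball 0 1]

instance : IsProbabilityMeasure discLaw :=
  cond_isProbabilityMeasure_of_finite (Metric.measure_ball_pos volume _ one_pos).ne'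
    measure_ball_lt_top.ne

theorem ae_discLaw_ne_zero : ∀ᵐ x ∂discLaw, x ≠ 0 :=
  cond_absolutelyContinuous.ae_le (measure_eq_zero_iff_ae_notMem.mp (measure_singleton 0))

theorem measurable_fiberMap_prod {d k : ℕ} (F : PF d (k - 1) (k + 1)) :
    Measurable fun p : GL (Fin d) ℝ × fiber F => fiberMap F p.1 p.2 :=
  (Gr.continuous_act.comp
    (continuous_fst.prodMk (continuous_subtype_val.comp continuous_snd))).measurable

theorem measurable_fiberMap {d k : ℕ} (F : PF d (k - 1) (k + 1)) (A : GL (Fin d) ℝ) :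
    Measurable (fiberMap F A) :=
  (Gr.continuous_act.comp (continuous_const.prodMk continuous_subtype_val)).measurable

section Law

variable {d k : ℕ} (hk : 1 ≤ k) (F : PF d (k - 1) (k + 1))

/-- The uniform law on the miniflag of `F`, as a measure on the Grassmannian. -/
def PF.law : Measure (Gr d k) :=
  discLaw.map (F.line hk)

instance : IsProbabilityMeasure (F.law hk) :=
  Measure.isProbabilityMeasure_map (F.measurable_line hk).aemeasurable

/-- The uniform law on the miniflag of `F`, as a measure on the miniflag itself. -/
def PF.fiberLaw : Measure (fiber F) :=
  discLaw.map fun x => ⟨F.line hk x, F.line_mem_fiber hk x⟩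

theorem PF.measurable_line_fiber :
    Measurable fun x => (⟨F.line hk x, F.line_mem_fiber hk x⟩ : fiber F) :=
  (F.measurable_line hk).subtype_mk

instance : IsProbabilityMeasure (F.fiberLaw hk) :=
  Measure.isProbabilityMeasure_map (F.measurable_line_fiber hk).aemeasurable

theorem map_fiberMap_fiberLaw (A : GL (Fin d) ℝ) : (F.fiberLaw hk).map (fiberMap F A) =
    discLaw.map fun x => (PF.act A F).line hk (planeMap hk A F x) := by
  rw [PF.fiberLaw, Measure.map_map (measurable_fiberMap F A) (F.measurable_line_fiber hk)]
  exact Measure.map_congr (ae_discLaw_ne_zero.mono fun x hx => act_line hk A F hx)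

theorem map_fiberMap_fiberLaw_le (A : GL (Fin d) ℝ) : (F.fiberLaw hk).map (fiberMap F A) ≤
    ENNReal.ofReal (sv (perpMap A F) 1 / sv (perpMap A F) 2) • (PF.act A F).law hk := by
  have h1 : 0 < sv (perpMap A F) 1 := sv_perpMap_pos A F le_rfl (by omega)
  have h2 : 0 < sv (perpMap A F) 2 := sv_perpMap_pos A F one_le_two (by omega)
  have hdet0 : LinearMap.det (planeMap hk A F) ≠ 0 := by
    rw [← abs_pos, abs_det_planeMap hk A F]
    exact mul_pos h1 h2
  have hline := (PF.act A F).measurable_line hk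
  have hplane : Measurable (planeMap hk A F) :=
    (planeMap hk A F).continuous_of_finiteDimensional.measurable
  refine Measure.le_iff.mpr fun S hS => ?_
  set Z : Set (EuclideanSpace ℝ (Fin 2)) := (PF.act A F).line hk ⁻¹' S with hZ
  have hnull : planeMap hk A F ⁻¹' Z =ᵐ[discLaw] planeMap hk A F ⁻¹' (Z \ {0}) :=
    ae_discLaw_ne_zero.mono fun x hx =>
      propext (and_iff_left (planeMap_ne_zero hk A F hx)).symm
  have hcone : ∀ y ∈ Z \ {0}, (sv (perpMap A F) 1)⁻¹ • y ∈ Z \ {0} := by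
    rintro y ⟨hy, hy0⟩
    refine ⟨?_, smul_ne_zero (inv_ne_zero h1.ne') hy0⟩
    rwa [hZ, Set.mem_preimage, PF.line_smul hk _ (inv_ne_zero h1.ne') hy0]
  calc (F.fiberLaw hk).map (fiberMap F A) S
      = discLaw (planeMap hk A F ⁻¹' Z) := by
        rw [map_fiberMap_fiberLaw,
          Measure.map_apply (f := fun x => (PF.act A F).line hk (planeMap hk A F x))
            (hline.comp hplane) hS]
        rfl
    _ = discLaw (planeMap hk A F ⁻¹' (Z \ {0})) := measure_congr hnull
    _ ≤ ENNReal.ofReal (sv (perpMap A F) 1 ^ 2 / |LinearMap.det (planeMap hk A F)|) *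
          discLaw (Z \ {0}) := by
        have h := cond_ball_preimage_le volume h1 hdet0 (norm_planeMap_le hk A F) hcone
        rwa [finrank_euclideanSpace_fin] at h
    _ ≤ ENNReal.ofReal (sv (perpMap A F) 1 / sv (perpMap A F) 2) * discLaw Z := by
        rw [abs_det_planeMap, sq, mul_div_mul_left _ _ h1.ne']
        gcongr
        exact Set.sdiff_subset
    _ = _ := by rw [Measure.smul_apply, PF.law, Measure.map_apply hline hS, smul_eq_mul]

theorem map_fiberMap_fiberLaw_absolutelyContinuous (A : GL (Fin d) ℝ) :
    (F.fiberLaw hk).map (fiberMap F A) ≪ (PF.act A F).law hk :=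
  (Measure.absolutelyContinuous_of_le (map_fiberMap_fiberLaw_le hk F A)).trans
    Measure.smul_absolutelyContinuous

/-- The law, depending on the matrix `A`, of the image under `A` of a uniform random point of the
miniflag of `F`. -/
def PF.imageKernel : Kernel (GL (Fin d) ℝ) (Gr d k) where
  toFun A := (F.fiberLaw hk).map (fiberMap F A)
  measurable' := by
    refine Measure.measurable_of_measurable_coe _ fun S hS => ?_
    simp_rw [fun A => Measure.map_apply (μ := F.fiberLaw hk) (measurable_fiberMap F A) hS]
    exact measurable_measure_prodMk_left (measurable_fiberMap_prod F hS)

instance : IsMarkovKernel (F.imageKernel hk) :=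
  ⟨fun A => Measure.isProbabilityMeasure_map (measurable_fiberMap F A).aemeasurable⟩

include hk in
theorem pushforwardEntropy_le (F' : PF d (k - 1) (k + 1)) (η : Measure (GL (Fin d) ℝ))
    [IsProbabilityMeasure η] (h : ∀ᵐ A ∂η, PF.act A F = F') :
    pushforwardEntropy (fiberMap F) η ≤
      ∫⁻ A, ENNReal.ofReal (Real.log (sv (perpMap A F) 1 / sv (perpMap A F) 2)) ∂η := by
  have hac : ∀ᵐ A ∂η, F.imageKernel hk A ≪ F'.law hk :=
    h.mono fun A hA => hA ▸ map_fiberMap_fiberLaw_absolutelyContinuous hk F A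
  calc pushforwardEntropy (fiberMap F) η
      ≤ furstenbergEntropy (fiberMap F) η (F.fiberLaw hk) :=
        iInf_le (fun ν : ProbabilityMeasure (fiber F) =>
          furstenbergEntropy (fiberMap F) η (ν : Measure (fiber F))) ⟨F.fiberLaw hk, inferInstance⟩
    _ ≤ ∫⁻ A, klDiv (F.imageKernel hk A) (F'.law hk) ∂η := lintegral_klDiv_comp_le hac
    _ ≤ _ := lintegral_mono_ae <| h.mono fun A hA =>
        klDiv_le_log_of_le_smul (hA ▸ map_fiberMap_fiberLaw_le hk F A)

end Law

section Haar

variable {d k : ℕ} (hk : 1 ≤ k) (hkd : k < d) (μ : Measure (GL (Fin d) ℝ)) [IsProbabilityMeasure μ]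

include hk hkd in
theorem measurable_log_sv_perpMap_div :
    Measurable fun p : GL (Fin d) ℝ × PF d (k - 1) (k + 1) =>
      Real.log (sv (perpMap p.1 p.2) 1 / sv (perpMap p.1 p.2) 2) :=
  Real.measurable_log.comp (measurable_sv_perpMap_div hk hkd)

theorem ae_condDistrib_id_eq {Ω X : Type*} [MeasurableSpace Ω] [StandardBorelSpace Ω] [Nonempty Ω]
    [MeasurableSpace X] [MeasurableEq X] (ν : Measure Ω) [IsFiniteMeasure ν] {q : Ω → X}
    (hq : Measurable q) : ∀ᵐ x ∂(ν.map q), ∀ᵐ ω ∂(condDistrib id q ν x), q ω = x := by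
  refine Measure.ae_ae_of_ae_compProd (p := fun z : X × Ω => q z.2 = z.1) ?_
  have hs : MeasurableSet {z : X × Ω | q z.2 = z.1} :=
    measurableSet_eq_fun (hq.comp measurable_snd) measurable_fst
  rw [compProd_map_condDistrib aemeasurable_id,
    ae_map_iff (hq.prodMk measurable_id).aemeasurable hs]
  exact Filter.Eventually.of_forall fun _ => rfl

include hk hkd in
theorem hFA_le (F : PF d (k - 1) (k + 1)) : hFA F μ ≤
    ∫⁻ A, ENNReal.ofReal (Real.log (sv (perpMap A F) 1 / sv (perpMap A F) 2)) ∂μ := by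
  set q : GL (Fin d) ℝ → PF d (k - 1) (k + 1) := fun A => PF.act A F
  have hq : Measurable q := measurable_act_right F
  have : IsProbabilityMeasure (μ.map q) := Measure.isProbabilityMeasure_map hq.aemeasurable
  set g : GL (Fin d) ℝ → ℝ≥0∞ := fun A =>
    ENNReal.ofReal (Real.log (sv (perpMap A F) 1 / sv (perpMap A F) 2))
  have hg : Measurable g :=
    ((measurable_log_sv_perpMap_div hk hkd).comp measurable_prodMk_right).ennreal_ofReal
  calc hFA F μ ≤ ∫⁻ F', ∫⁻ A, g A ∂(condDistrib id q μ F') ∂(μ.map q) :=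
        lintegral_mono_ae <| (ae_condDistrib_id_eq μ hq).mono fun F' hF' =>
          pushforwardEntropy_le hk F F' (condDistrib id q μ F') hF'
    _ = ∫⁻ z, g z.2 ∂((μ.map q) ⊗ₘ condDistrib id q μ) :=
        (Measure.lintegral_compProd (hg.comp measurable_snd)).symm
    _ = ∫⁻ A, g A ∂μ := by
        rw [compProd_map_condDistrib aemeasurable_id]
        exact lintegral_map (hg.comp measurable_snd) (hq.prodMk measurable_id)

include hk in
theorem lintegral_log_sv_perpMap_div_le {C : ℝ} (hC : IsGapConstant d C) (A : GL (Fin d) ℝ) :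
    ∫⁻ F : PF d (k - 1) (k + 1),
        ENNReal.ofReal (Real.log (sv (perpMap A F) 1 / sv (perpMap A F) 2))
          ∂(haarPF (pred_le_succ k) hkd) ≤
      ENNReal.ofReal (Real.log (sv (lin A) k) - Real.log (sv (lin A) (k + 1))) +
        ENNReal.ofReal C := by
  obtain ⟨hint, hle⟩ := hC k hk hkd A
  rw [Real.log_div (sv_lin_pos A hk hkd.le).ne' (sv_lin_pos A (by omega) hkd).ne'] at hle
  have hnonneg (F : PF d (k - 1) (k + 1)) :
      0 ≤ Real.log (sv (perpMap A F) 1 / sv (perpMap A F) 2) := by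
    refine Real.log_nonneg ((one_le_div (sv_perpMap_pos A F one_le_two (by omega))).mpr ?_)
    exact sv_antitone _ one_le_two
  rw [← ofReal_integral_eq_lintegral_ofReal hint (Filter.Eventually.of_forall hnonneg)]
  refine (ENNReal.ofReal_le_ofReal ?_).trans ENNReal.ofReal_add_le
  linarith [(abs_le.mp hle).2]

include hk in
theorem lintegral_hFA_le {C : ℝ} (hC : IsGapConstant d C) :
    ∫⁻ F : PF d (k - 1) (k + 1), hFA F μ ∂(haarPF (pred_le_succ k) hkd) ≤
      ∫⁻ A, ENNReal.ofReal (Real.log (sv (lin A) k) - Real.log (sv (lin A) (k + 1))) ∂μ +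
        ENNReal.ofReal C := by
  set m := haarPF (pred_le_succ k) hkd
  set g : GL (Fin d) ℝ × PF d (k - 1) (k + 1) → ℝ≥0∞ := fun p =>
    ENNReal.ofReal (Real.log (sv (perpMap p.1 p.2) 1 / sv (perpMap p.1 p.2) 2))
  have hg : Measurable g := (measurable_log_sv_perpMap_div hk hkd).ennreal_ofReal
  calc ∫⁻ F, hFA F μ ∂m ≤ ∫⁻ F, ∫⁻ A, g (A, F) ∂μ ∂m :=
        lintegral_mono fun F => hFA_le hk hkd μ F
    _ = ∫⁻ A, ∫⁻ F, g (A, F) ∂m ∂μ :=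
        lintegral_lintegral_swap (hg.comp measurable_swap).aemeasurable
    _ ≤ ∫⁻ A, (ENNReal.ofReal (Real.log (sv (lin A) k) - Real.log (sv (lin A) (k + 1))) +
          ENNReal.ofReal C) ∂μ :=
        lintegral_mono fun A => lintegral_log_sv_perpMap_div_le hk hkd hC A
    _ = _ := by
        rw [lintegral_add_right _ measurable_const, lintegral_const, measure_univ, mul_one]

end Haar

/-! ### Logarithmic integrability of the minors of Haar distributed frames -/

/-- The singularity `|x| ^ (-1/2)`, infinite at `0`. It dominates `|log x|` near `0`, and unlike
the logarithm it is multiplicative. -/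
def invSqrt (x : ℝ) : ℝ≥0∞ := ‖x‖ₑ ^ (-(1 / 2) : ℝ)

@[fun_prop]
theorem measurable_invSqrt : Measurable invSqrt := by
  unfold invSqrt
  fun_prop

theorem invSqrt_zero : invSqrt 0 = ∞ := by
  rw [invSqrt, enorm_zero, ENNReal.zero_rpow_of_neg (by norm_num)]

theorem invSqrt_one : invSqrt 1 = 1 := by simp [invSqrt]

theorem invSqrt_ne_zero (x : ℝ) : invSqrt x ≠ 0 := by simp [invSqrt]

theorem invSqrt_mul (x y : ℝ) : invSqrt (x * y) = invSqrt x * invSqrt y := by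
  rw [invSqrt, enorm_mul, ENNReal.mul_rpow_of_ne_top enorm_ne_top enorm_ne_top, invSqrt, invSqrt]

theorem invSqrt_anti {x y : ℝ} (h : |x| ≤ |y|) : invSqrt y ≤ invSqrt x := by
  rw [invSqrt, invSqrt, ENNReal.rpow_neg, ENNReal.rpow_neg, ENNReal.inv_le_inv]
  exact ENNReal.rpow_le_rpow (enorm_le_iff_norm_le.mpr h) (by norm_num)

theorem invSqrt_of_ne_zero {x : ℝ} (hx : x ≠ 0) :
    invSqrt x = ENNReal.ofReal (|x| ^ (-(1 / 2) : ℝ)) := by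
  rw [invSqrt, ← ofReal_norm, Real.norm_eq_abs, ENNReal.ofReal_rpow_of_pos (abs_pos.mpr hx)]

theorem enorm_log_le (x : ℝ) : ‖Real.log x‖ₑ ≤ 2 * invSqrt x + ‖x‖ₑ := by
  rcases eq_or_ne x 0 with rfl | hx
  · simp
  have hx' : 0 < |x| := abs_pos.mpr hx
  rw [invSqrt_of_ne_zero hx, ← ofReal_norm, ← ofReal_norm, Real.norm_eq_abs, Real.norm_eq_abs,
    ← Real.log_abs x, ← ENNReal.ofReal_ofNat, ← ENNReal.ofReal_mul (by norm_num),
    ← ENNReal.ofReal_add (by positivity) (by positivity)]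
  refine ENNReal.ofReal_le_ofReal ?_
  have hup := Real.log_le_self hx'.le
  have hlo := Real.log_le_rpow_div (x := |x|⁻¹) (by positivity) (ε := 1 / 2) (by norm_num)
  rw [Real.log_inv, Real.inv_rpow hx'.le, ← Real.rpow_neg hx'.le] at hlo
  have hp : 0 ≤ |x| ^ (-(1 / 2) : ℝ) := by positivity
  rw [abs_le]
  constructor <;> linarith

theorem setLIntegral_invSqrt_lt_top : ∫⁻ t in Set.Icc (-1 : ℝ) 1, invSqrt t < ∞ := by
  have hcpow := (intervalIntegral.intervalIntegrable_cpow' (a := -1) (b := 1)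
    (r := ((-(1 / 2) : ℝ) : ℂ)) (by norm_num)).norm
  rw [intervalIntegrable_iff_integrableOn_Icc_of_le (by norm_num)] at hcpow
  refine lt_of_eq_of_lt (lintegral_congr_ae ?_) hcpow.2
  filter_upwards [ae_restrict_of_ae (Measure.ae_ne volume (0 : ℝ))] with t ht
  rw [invSqrt_of_ne_zero ht, Complex.norm_cpow_real, Complex.norm_real, Real.norm_eq_abs,
    Real.enorm_of_nonneg (by positivity)]

theorem gaussianPDF_zero_one_le_one (x : ℝ) : gaussianPDF 0 1 x ≤ 1 := by
  rw [gaussianPDF, gaussianPDFReal, ENNReal.ofReal_le_one]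
  refine mul_le_one₀ (inv_le_one_of_one_le₀ ?_) (Real.exp_pos _).le (Real.exp_le_one_iff.mpr ?_)
  · rw [Real.one_le_sqrt, NNReal.coe_one, mul_one]
    linarith [Real.pi_gt_three]
  · exact div_nonpos_of_nonpos_of_nonneg (neg_nonpos.mpr (sq_nonneg _)) (by positivity)

/-- The constant `𝔼 |X| ^ (-1/2)` for a standard normal variable `X`. -/
def gaussConst : ℝ≥0∞ := ∫⁻ t, invSqrt t ∂(gaussianReal 0 1)

theorem gaussConst_ne_top : gaussConst ≠ ∞ := by
  have hle (t : ℝ) : invSqrt t ≤ 1 + (Set.Icc (-1 : ℝ) 1).indicator invSqrt t := by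
    by_cases ht : t ∈ Set.Icc (-1 : ℝ) 1
    · rw [Set.indicator_of_mem ht]
      exact le_add_self
    · rw [Set.mem_Icc, ← abs_le, not_le] at ht
      refine le_add_of_le_left ((invSqrt_anti ?_).trans_eq invSqrt_one)
      rw [abs_one]
      exact ht.le
  refine ((lintegral_mono hle).trans_lt ?_).ne
  rw [lintegral_add_left measurable_const, lintegral_one, measure_univ,
    lintegral_indicator measurableSet_Icc, gaussianReal_of_var_ne_zero 0 one_ne_zero,
    setLIntegral_withDensity_eq_setLIntegral_mul _ (measurable_gaussianPDF 0 1)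
      measurable_invSqrt measurableSet_Icc]
  refine ENNReal.add_lt_top.mpr ⟨ENNReal.one_lt_top, lt_of_le_of_lt (lintegral_mono fun t => ?_)
    setLIntegral_invSqrt_lt_top⟩
  exact mul_le_of_le_one_left' (gaussianPDF_zero_one_le_one t)

section MixedGram

variable {E : Type*} [NormedAddCommGroup E] [InnerProductSpace ℝ E] {n : ℕ}

/-- The mixed Gram determinant `det ⟨v a, w c⟩`. For orthonormal `w` it is a maximal minor of the
coordinate matrix of `v`. -/
def mixedGramDet (v w : Fin n → E) : ℝ := (Matrix.of fun a c => inner ℝ (v a) (w c)).det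

@[fun_prop]
theorem continuous_mixedGramDet {X : Type*} [TopologicalSpace X] {v w : X → Fin n → E}
    (hv : Continuous v) (hw : Continuous w) : Continuous fun x => mixedGramDet (v x) (w x) :=
  Continuous.matrix_det (continuous_matrix fun a c => by fun_prop)

theorem mixedGramDet_sum_smul (A : Matrix (Fin n) (Fin n) ℝ) (u w : Fin n → E) :
    mixedGramDet (fun a => ∑ i, A a i • u i) w = A.det * mixedGramDet u w := by
  rw [mixedGramDet, mixedGramDet, ← Matrix.det_mul]
  congr 1
  ext a c
  simp [Matrix.mul_apply, sum_inner, inner_smul_left]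

theorem linearIndependent_of_mixedGramDet_ne_zero {v w : Fin n → E} (h : mixedGramDet v w ≠ 0) :
    LinearIndependent ℝ v := by
  refine Fintype.linearIndependent_iff.mpr fun g hg a => ?_
  refine congrFun (Matrix.eq_zero_of_vecMul_eq_zero h (v := g) ?_) a
  ext c
  rw [Matrix.vecMul, Pi.zero_apply, ← inner_zero_left (w c), ← hg, sum_inner]
  simp [dotProduct, inner_smul_left]

/-- Expanding along the first row writes the determinant as the inner product of the first vector
with a vector at least as long as the complementary minor. -/
theorem exists_mixedGramDet_cons_eq_inner {b : Fin (n + 1) → E} (hb : Orthonormal ℝ b)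
    (v : Fin n → E) : ∃ w : E, (∀ x, mixedGramDet (Fin.cons x v) b = inner ℝ x w) ∧
      |mixedGramDet v (b ∘ Fin.succ)| ≤ ‖w‖ := by
  set M : Fin (n + 1) → ℝ := fun j => (-1) ^ (j : ℕ) * mixedGramDet v (b ∘ j.succAbove) with hM
  refine ⟨∑ j, M j • b j, fun x => ?_, ?_⟩
  · rw [mixedGramDet, Matrix.det_succ_row_zero, inner_sum]
    refine Finset.sum_congr rfl fun j _ => ?_
    rw [inner_smul_right, hM, mul_right_comm]
    rfl
  · have h0 : inner ℝ (b 0) (∑ j, M j • b j) = mixedGramDet v (b ∘ Fin.succ) := by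
      rw [hb.inner_right_fintype, hM]
      simp
    rw [← h0]
    exact (abs_real_inner_le_norm _ _).trans_eq (by rw [hb.1, one_mul])

theorem exists_orthonormal_eq_sum_smul {v : Fin n → E} (hv : LinearIndependent ℝ v) :
    ∃ (u : Fin n → E) (A : Matrix (Fin n) (Fin n) ℝ), Orthonormal ℝ u ∧
      v = fun a => ∑ i, A a i • u i := by
  have hdim : finrank ℝ (Submodule.span ℝ (Set.range v)) = n := by
    rw [finrank_span_eq_card hv, Fintype.card_fin]
  have := FiniteDimensional.span_of_finite ℝ (Set.finite_range v)
  set u := (stdOrthonormalBasis ℝ (Submodule.span ℝ (Set.range v))).reindex (finCongr hdim)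
  have hmem (a : Fin n) : v a ∈ Submodule.span ℝ (Set.range v) := Submodule.subset_span ⟨a, rfl⟩
  refine ⟨fun i => u i, Matrix.of fun a i => u.repr ⟨v a, hmem a⟩ i,
    u.orthonormal.comp_linearIsometry (Submodule.subtypeₗᵢ _), funext fun a => ?_⟩
  exact congrArg Subtype.val (u.sum_repr ⟨v a, hmem a⟩).symm |>.trans (by simp)

end MixedGram

section Gaussian

variable {E : Type*} [NormedAddCommGroup E] [InnerProductSpace ℝ E] [FiniteDimensional ℝ E]
  [MeasurableSpace E] [BorelSpace E]

theorem map_inner_stdGaussian (w : E) :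
    (stdGaussian E).map (fun v => inner ℝ v w) = (gaussianReal 0 1).map (‖w‖ * ·) := by
  have h := IsGaussian.map_eq_gaussianReal (μ := stdGaussian E) (innerSL ℝ w)
  rw [integral_strongDual_stdGaussian, variance_dual_stdGaussian, innerSL_apply_norm] at h
  rw [gaussianReal_map_const_mul, mul_zero, mul_one]
  simp_rw [real_inner_comm w]
  exact h.trans (congrArg _ (Real.toNNReal_of_nonneg (sq_nonneg _)))

theorem lintegral_invSqrt_inner_stdGaussian (w : E) :
    ∫⁻ v, invSqrt (inner ℝ v w) ∂(stdGaussian E) = invSqrt ‖w‖ * gaussConst := by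
  have hinner : Measurable fun v : E => inner ℝ v w := measurable_id.inner_const
  rw [← lintegral_map measurable_invSqrt hinner, map_inner_stdGaussian,
    lintegral_map measurable_invSqrt (measurable_const_mul _)]
  simp_rw [invSqrt_mul]
  exact lintegral_const_mul _ measurable_invSqrt

theorem lintegral_invSqrt_mixedGramDet_stdGaussian_le {n : ℕ} {b : Fin n → E}
    (hb : Orthonormal ℝ b) :
    ∫⁻ v, invSqrt (mixedGramDet v b) ∂(Measure.pi fun _ : Fin n => stdGaussian E) ≤
      gaussConst ^ n := by
  induction n with
  | zero => simp [mixedGramDet, invSqrt_one]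
  | succ n ih =>
    have hmeas {m : ℕ} (b : Fin m → E) : Measurable fun v => invSqrt (mixedGramDet v b) :=
      measurable_invSqrt.comp (continuous_mixedGramDet continuous_id continuous_const).measurable
    have hmp := (measurePreserving_piFinSuccAbove (fun _ : Fin (n + 1) => stdGaussian E) 0).symm
    calc ∫⁻ v, invSqrt (mixedGramDet v b) ∂(Measure.pi fun _ : Fin (n + 1) => stdGaussian E)
        = ∫⁻ v, ∫⁻ x, invSqrt (mixedGramDet (Fin.cons x v) b)
            ∂(stdGaussian E) ∂(Measure.pi fun _ : Fin n => stdGaussian E) := by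
          rw [← hmp.lintegral_comp (hmeas b)]
          refine (lintegral_prod_symm' (μ := stdGaussian E)
            (ν := Measure.pi fun _ : Fin n => stdGaussian E) _
            ((hmeas b).comp hmp.measurable)).trans ?_
          simp [MeasurableEquiv.piFinSuccAbove, Fin.insertNthEquiv]
      _ ≤ ∫⁻ v, invSqrt (mixedGramDet v (b ∘ Fin.succ)) * gaussConst
            ∂(Measure.pi fun _ : Fin n => stdGaussian E) := by
          refine lintegral_mono fun v => ?_
          obtain ⟨w, hw, hle⟩ := exists_mixedGramDet_cons_eq_inner hb v
          simp_rw [hw, lintegral_invSqrt_inner_stdGaussian]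
          gcongr
          exact invSqrt_anti (by rwa [abs_norm])
      _ ≤ gaussConst ^ (n + 1) := by
          rw [lintegral_mul_const _ (hmeas _), pow_succ]
          gcongr
          exact ih (hb.comp _ (Fin.succ_injective n))

end Gaussian

section Haar

variable {d n : ℕ}

/-- The normalized Haar measure on `O(d)`. -/
abbrev haarO (d : ℕ) : Measure (Matrix.orthogonalGroup (Fin d) ℝ) :=
  Measure.haarMeasure (⊤ : TopologicalSpace.PositiveCompacts (Matrix.orthogonalGroup (Fin d) ℝ))

instance : IsProbabilityMeasure (haarO d) := ⟨Measure.haarMeasure_self⟩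

instance : (haarO d).IsMulRightInvariant where
  map_mul_right_eq_self g := by
    have := Measure.isProbabilityMeasure_map (μ := haarO d) (measurable_mul_const g).aemeasurable
    exact Measure.isHaarMeasure_eq_of_isProbabilityMeasure _ _

instance : SecondCountableTopology (Matrix.orthogonalGroup (Fin d) ℝ) :=
  have : SecondCountableTopology (Matrix (Fin d) (Fin d) ℝ) :=
    inferInstanceAs (SecondCountableTopology (Fin d → Fin d → ℝ))
  inferInstanceAs (SecondCountableTopology
    {x // x ∈ (Matrix.orthogonalGroup (Fin d) ℝ : Set (Matrix (Fin d) (Fin d) ℝ))})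

/-- Orthogonal matrices as the linear isometries of Euclidean space. -/
def orthoIsometry (d : ℕ) : Matrix.orthogonalGroup (Fin d) ℝ ≃*
    (EuclideanSpace ℝ (Fin d) ≃ₗᵢ[ℝ] EuclideanSpace ℝ (Fin d)) :=
  let e := Matrix.toEuclideanCLM (n := Fin d) (𝕜 := ℝ)
  (Unitary.mapEquiv ⟨e, fun A => map_star e A⟩).toMulEquiv.trans Unitary.linearIsometryEquiv

@[fun_prop]
theorem continuous_orthoIsometry_apply {X : Type*} [TopologicalSpace X]
    {f : X → Matrix.orthogonalGroup (Fin d) ℝ} {g : X → EuclideanSpace ℝ (Fin d)}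
    (hf : Continuous f) (hg : Continuous g) :
    Continuous fun x => orthoIsometry d (f x) (g x) :=
  ((continuous_clm d).comp ((continuous_toUnits d).comp hf)).clm_apply hg

theorem exists_orthoIsometry_apply_eq {u u' : Fin n → EuclideanSpace ℝ (Fin d)}
    (hu : Orthonormal ℝ u) (hu' : Orthonormal ℝ u') :
    ∃ V, ∀ a, orthoIsometry d V (u a) = u' a := by
  set b := Basis.span hu.linearIndependent
  have hb (a : Fin n) : (b a : EuclideanSpace ℝ (Fin d)) = u a :=
    congrArg Subtype.val (Basis.span_apply _ a)
  have hon : Orthonormal ℝ b := by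
    rw [← (Submodule.subtypeₗᵢ _).orthonormal_comp_iff]
    exact (funext hb : (Submodule.subtypeₗᵢ _) ∘ b = u).symm ▸ hu
  have hcomp : b.constr ℝ u' ∘ b = u' := funext fun a => b.constr_basis ℝ u' a
  set f := ((b.constr ℝ u').isometryOfOrthonormal hon (hcomp.symm ▸ hu')).extend
  refine ⟨(orthoIsometry d).symm (f.toLinearIsometryEquiv rfl), fun a => ?_⟩
  rw [MulEquiv.apply_symm_apply, LinearIsometry.toLinearIsometryEquiv_apply, ← hb,
    LinearIsometry.extend_apply]
  exact congrFun hcomp a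

/-- The minor `det ⟨U (u a), b c⟩` of an orthogonal matrix `U` with respect to the frames `u` and
`b`. -/
def frameMinor (u b : Fin n → EuclideanSpace ℝ (Fin d))
    (U : Matrix.orthogonalGroup (Fin d) ℝ) : ℝ :=
  mixedGramDet (fun a => orthoIsometry d U (u a)) b

@[fun_prop]
theorem continuous_frameMinor {X : Type*} [TopologicalSpace X]
    {u b : X → Fin n → EuclideanSpace ℝ (Fin d)} {f : X → Matrix.orthogonalGroup (Fin d) ℝ}
    (hu : Continuous u) (hb : Continuous b) (hf : Continuous f) :
    Continuous fun x => frameMinor (u x) (b x) (f x) :=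
  continuous_mixedGramDet (continuous_pi fun a =>
    continuous_orthoIsometry_apply hf ((continuous_apply a).comp hu)) hb

theorem measurable_invSqrt_frameMinor (u b : Fin n → EuclideanSpace ℝ (Fin d)) :
    Measurable fun U => invSqrt (frameMinor u b U) :=
  measurable_invSqrt.comp (by fun_prop : Continuous (frameMinor u b)).measurable

theorem frameMinor_mul (u b : Fin n → EuclideanSpace ℝ (Fin d))
    (U V : Matrix.orthogonalGroup (Fin d) ℝ) :
    frameMinor u b (U * V) = frameMinor (fun a => orthoIsometry d V (u a)) b U := by
  simp only [frameMinor, map_mul, LinearIsometryEquiv.coe_mul, Function.comp_apply]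

theorem frameMinor_orthoIsometry_mul (u b : Fin n → EuclideanSpace ℝ (Fin d))
    (U V : Matrix.orthogonalGroup (Fin d) ℝ) :
    frameMinor u (fun a => orthoIsometry d V (b a)) (V * U) = frameMinor u b U := by
  simp only [frameMinor, mixedGramDet, map_mul, LinearIsometryEquiv.coe_mul, Function.comp_apply,
    LinearIsometryEquiv.inner_map_map]

theorem frameMinor_orthoIsometry (v b : Fin n → EuclideanSpace ℝ (Fin d))
    (U : Matrix.orthogonalGroup (Fin d) ℝ) :
    frameMinor v (fun a => orthoIsometry d U (b a)) U = mixedGramDet v b := by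
  simp only [frameMinor, mixedGramDet, LinearIsometryEquiv.inner_map_map]

theorem frameMinor_sum_smul (A : Matrix (Fin n) (Fin n) ℝ)
    (u b : Fin n → EuclideanSpace ℝ (Fin d)) (U : Matrix.orthogonalGroup (Fin d) ℝ) :
    frameMinor (fun a => ∑ i, A a i • u i) b U = A.det * frameMinor u b U := by
  simp only [frameMinor, map_sum, map_smul, mixedGramDet_sum_smul]

/-- For each `U` the Gaussian average is that of the frame `U⁻¹ b`, hence at most `gaussConst ^ n`;
so by Tonelli the average over `U` is finite for some frame `v`. -/
theorem exists_lintegral_invSqrt_frameMinor_ne_top {b : Fin n → EuclideanSpace ℝ (Fin d)}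
    (hb : Orthonormal ℝ b) : ∃ v, ∫⁻ U, invSqrt (frameMinor v b U) ∂(haarO d) ≠ ∞ := by
  set γ := Measure.pi fun _ : Fin n => stdGaussian (EuclideanSpace ℝ (Fin d))
  have hmeas : Measurable (Function.uncurry fun v U => invSqrt (frameMinor v b U)) :=
    measurable_invSqrt.comp (continuous_frameMinor continuous_fst continuous_const
      continuous_snd).measurable
  have hinner (U) : ∫⁻ v, invSqrt (frameMinor v b U) ∂γ ≤ gaussConst ^ n := by
    obtain ⟨b', rfl⟩ : ∃ b', b = fun a => orthoIsometry d U (b' a) :=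
      ⟨fun a => (orthoIsometry d U).symm (b a), by simp⟩
    simp_rw [frameMinor_orthoIsometry]
    exact lintegral_invSqrt_mixedGramDet_stdGaussian_le
      ((orthoIsometry d U).toLinearIsometry.orthonormal_comp_iff.mp hb)
  have hfin : ∫⁻ v, ∫⁻ U, invSqrt (frameMinor v b U) ∂(haarO d) ∂γ ≠ ∞ := by
    rw [lintegral_lintegral_swap hmeas.aemeasurable]
    refine ne_top_of_le_ne_top (ENNReal.pow_ne_top gaussConst_ne_top (n := n)) ?_
    exact (lintegral_mono hinner).trans_eq (by rw [lintegral_const, measure_univ, mul_one])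
  obtain ⟨v, hv⟩ := (ae_lt_top hmeas.lintegral_prod_right hfin).exists
  exact ⟨v, hv.ne⟩

theorem lintegral_invSqrt_frameMinor_ne_top {u b : Fin n → EuclideanSpace ℝ (Fin d)}
    (hu : Orthonormal ℝ u) (hb : Orthonormal ℝ b) :
    ∫⁻ U, invSqrt (frameMinor u b U) ∂(haarO d) ≠ ∞ := by
  obtain ⟨v, hv⟩ := exists_lintegral_invSqrt_frameMinor_ne_top hb
  have hli : LinearIndependent ℝ v := by
    by_contra hli
    have h0 (U) : frameMinor v b U = 0 := by
      by_contra h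
      exact hli ((linearIndependent_of_mixedGramDet_ne_zero h).of_comp
        (orthoIsometry d U).toLinearIsometry.toLinearMap)
    refine hv ?_
    simp_rw [h0, invSqrt_zero, lintegral_const, measure_univ, mul_one]
  obtain ⟨u', A, hu', rfl⟩ := exists_orthonormal_eq_sum_smul hli
  obtain ⟨V, hV⟩ := exists_orthoIsometry_apply_eq hu hu'
  simp_rw [frameMinor_sum_smul, invSqrt_mul] at hv
  rw [lintegral_const_mul _ (measurable_invSqrt_frameMinor u' b)] at hv
  rw [← lintegral_mul_right_eq_self _ V]
  simp_rw [frameMinor_mul, hV]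
  exact (ENNReal.lt_top_of_mul_ne_top_right hv (invSqrt_ne_zero _)).ne

theorem ae_frameMinor_ne_zero {u b : Fin n → EuclideanSpace ℝ (Fin d)}
    (hu : Orthonormal ℝ u) (hb : Orthonormal ℝ b) : ∀ᵐ U ∂(haarO d), frameMinor u b U ≠ 0 := by
  filter_upwards [ae_lt_top (measurable_invSqrt_frameMinor u b)
    (lintegral_invSqrt_frameMinor_ne_top hu hb)] with U hU h
  rw [h, invSqrt_zero] at hU
  exact hU.ne rfl

theorem integrable_log_frameMinor {u b : Fin n → EuclideanSpace ℝ (Fin d)}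
    (hu : Orthonormal ℝ u) (hb : Orthonormal ℝ b) :
    Integrable (fun U => Real.log (frameMinor u b U)) (haarO d) := by
  have hcont : Continuous (frameMinor u b) := by fun_prop
  refine ⟨hcont.measurable.log.aestronglyMeasurable, ?_⟩
  refine (lintegral_mono fun U => enorm_log_le _).trans_lt ?_
  rw [lintegral_add_right _ hcont.measurable.enorm,
    lintegral_const_mul _ (measurable_invSqrt_frameMinor u b)]
  exact ENNReal.add_lt_top.mpr ⟨ENNReal.mul_lt_top ENNReal.ofNat_lt_top
    (lintegral_invSqrt_frameMinor_ne_top hu hb).lt_top,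
    (hcont.integrable_of_hasCompactSupport (HasCompactSupport.of_compactSpace _)).2⟩

theorem integral_log_frameMinor_eq (u : Fin n → EuclideanSpace ℝ (Fin d))
    {b b' : Fin n → EuclideanSpace ℝ (Fin d)} (hb : Orthonormal ℝ b) (hb' : Orthonormal ℝ b') :
    ∫ U, Real.log (frameMinor u b U) ∂(haarO d) =
      ∫ U, Real.log (frameMinor u b' U) ∂(haarO d) := by
  obtain ⟨V, hV⟩ := exists_orthoIsometry_apply_eq hb hb'
  obtain rfl : (fun a => orthoIsometry d V (b a)) = b' := funext hV
  rw [← integral_mul_left_eq_self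
    (fun U => Real.log (frameMinor u (fun a => orthoIsometry d V (b a)) U)) V]
  simp_rw [frameMinor_orthoIsometry_mul]

end Haar

/-! ### Volumes of adapted frames -/

section AdaptedFrame

variable {d i j : ℕ} {ι κ : Type*} (B : GL (Fin d) ℝ) {F : PF d i j}
  {u : ι → EuclideanSpace ℝ (Fin d)} {w : κ → EuclideanSpace ℝ (Fin d)}

theorem orthonormal_sumElim (hu : Orthonormal ℝ u) (hspan : Submodule.span ℝ (Set.range u) = F.lo)
    (hw : Orthonormal ℝ w) (hmem : ∀ a, w a ∈ F.diff) : Orthonormal ℝ (Sum.elim u w) := by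
  classical
  have horth (a b) : inner ℝ (u a) (w b) = 0 :=
    Submodule.inner_right_of_mem_orthogonal (hspan ▸ Submodule.subset_span ⟨a, rfl⟩) (hmem b).2
  rw [← Matrix.gram_eq_one_iff_orthonormal (𝕜 := ℝ), gram_sumElim_of_orthogonal horth,
    Matrix.gram_eq_one_iff_orthonormal.mpr hu, Matrix.gram_eq_one_iff_orthonormal.mpr hw,
    Matrix.fromBlocks_one]

variable [Fintype ι] [Fintype κ] [DecidableEq ι] [DecidableEq κ]

theorem det_gram_map_sumElim (hspan : Submodule.span ℝ (Set.range u) = F.lo)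
    (hmem : ∀ a, w a ∈ F.diff) :
    (Matrix.gram ℝ fun a => lin B (Sum.elim u w a)).det =
      (Matrix.gram ℝ fun a => lin B (u a)).det *
        (Matrix.gram ℝ fun a => perpMap B F (w a)).det := by
  have hlo : Submodule.span ℝ (Set.range fun a => lin B (u a)) = (PF.act B F).lo := by
    change _ = F.lo.map (lin B)
    rw [← hspan, Submodule.map_span, ← Set.range_comp]
    rfl
  have hperp (a) : perpMap B F (w a) = lin B (w a) -
      (Submodule.span ℝ (Set.range fun a => lin B (u a))).starProjection (lin B (w a)) := by
    rw [perpMap_of_mem_diff B F (hmem a), starProjection_inf_orthogonal (PF.act B F).lo_le_hi,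
      FunLike.coe_sub, Pi.sub_apply, (PF.act B F).hi.starProjection_eq_self_iff.mpr
        (Submodule.mem_map_of_mem (hmem a).1), hlo]
  have helim : (fun a => lin B (Sum.elim u w a)) =
      Sum.elim (fun a => lin B (u a)) fun a => lin B (w a) := Sum.comp_elim (lin B) u w
  rw [helim, det_gram_sumElim]
  simp_rw [hperp]

theorem det_gram_perpMap (hw : Orthonormal ℝ w) (hmem : ∀ a, w a ∈ F.diff)
    (hcard : Fintype.card κ = finrank ℝ F.diff) :
    (Matrix.gram ℝ fun a => perpMap B F (w a)).det =
      ∏ n ∈ Finset.range (Fintype.card κ), sv (perpMap B F) (n + 1) ^ 2 := by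
  have horth : Orthonormal ℝ fun a => (⟨w a, hmem a⟩ : F.diff) := hw.codRestrict F.diff hmem
  let b : OrthonormalBasis κ ℝ F.diff := OrthonormalBasis.mk horth
    (horth.linearIndependent.span_eq_top_of_card_eq_finrank' hcard).ge
  have h := ((perpMap B F).domRestrict F.diff).normDet_sq_eq_det_gram b
  simp only [b, OrthonormalBasis.coe_mk, LinearMap.domRestrict_apply] at h
  have hprod : ((perpMap B F).domRestrict F.diff).normDet ^ 2 =
      ∏ n ∈ Finset.range (Fintype.card κ), sv (perpMap B F) (n + 1) ^ 2 := by
    rw [normDet_domRestrict_perpMap, ← Finset.prod_pow, hcard]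
  exact h.symm.trans hprod

theorem det_gram_map_mul_sv_perpMap_one_sq_le (hu : Orthonormal ℝ u)
    (hspan : Submodule.span ℝ (Set.range u) = F.lo) (hij : i < j) :
    (Matrix.gram ℝ fun a => lin B (u a)).det * sv (perpMap B F) 1 ^ 2 ≤
      ∏ n ∈ Finset.range (Fintype.card ι + 1), sv (lin B) (n + 1) ^ 2 := by
  have hd : j ≤ d := F.finrank_hi ▸ F.hi.finrank_le.trans_eq finrank_euclideanSpace_fin
  let w : Fin 1 → EuclideanSpace ℝ (Fin d) := fun _ => svBasis (perpMap B F) ⟨0, by omega⟩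
  have hw : Orthonormal ℝ w :=
    (svBasis (perpMap B F)).orthonormal.comp _ (Function.injective_of_subsingleton _)
  have hmem (a) : w a ∈ F.diff :=
    svBasis_mem (orthogonal_diff_le_ker_perpMap B F) (sv_perpMap_pos B F le_rfl hij).ne'
  have h := det_gram_map_le (lin B) (orthonormal_sumElim hu hspan hw hmem)
  rwa [det_gram_map_sumElim B hspan hmem, Matrix.det_fin_one, Matrix.gram_apply,
    real_inner_self_eq_norm_sq, norm_map_svBasis, Fintype.card_sum, Fintype.card_fin] at h

end AdaptedFrame

section Columns

variable {d n i j : ℕ}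

/-- The first `n` vectors of the standard basis of `ℝ^d`. -/
def stdFrame (h : n ≤ d) (a : Fin n) : EuclideanSpace ℝ (Fin d) :=
  EuclideanSpace.single (Fin.castLE h a) 1

theorem orthonormal_stdFrame (h : n ≤ d) : Orthonormal ℝ (stdFrame h) :=
  EuclideanSpace.orthonormal_single.comp _ (Fin.castLE_injective h)

theorem span_range_stdFrame (h : n ≤ d) :
    Submodule.span ℝ (Set.range (stdFrame h)) = coordSpace d n := by
  refine congrArg _ (Set.ext fun x => ⟨?_, ?_⟩)
  · rintro ⟨a, rfl⟩
    exact ⟨⟨Fin.castLE h a, a.2⟩, rfl⟩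
  · rintro ⟨⟨a, ha⟩, rfl⟩
    exact ⟨⟨a, ha⟩, rfl⟩

theorem stdFrame_mem_diff_coordFlag (hij : i ≤ j) (hjd : j ≤ d) (h : n ≤ d) {a : Fin n}
    (hia : i ≤ a) (haj : a < j) : stdFrame h a ∈ (coordFlag hij hjd).diff := by
  refine ⟨Submodule.subset_span ⟨⟨Fin.castLE h a, haj⟩, rfl⟩, ?_⟩
  have hle : coordSpace d i ≤ (Submodule.span ℝ {stdFrame h a})ᗮ := by
    refine Submodule.span_le.mpr ?_
    rintro _ ⟨⟨b, hb⟩, rfl⟩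
    refine Submodule.mem_orthogonal_singleton_iff_inner_right.mpr
      (EuclideanSpace.orthonormal_single.2 fun hab => ?_)
    exact hia.not_gt ((congrArg Fin.val hab).trans_lt hb)
  exact Submodule.le_orthogonal_iff_le_orthogonal.mp hle (Submodule.mem_span_singleton_self _)

theorem orthoIsometry_mem_diff_act {F : PF d i j} (U : Matrix.orthogonalGroup (Fin d) ℝ)
    {x : EuclideanSpace ℝ (Fin d)} (hx : x ∈ F.diff) :
    orthoIsometry d U x ∈ (PF.act (Unitary.toUnits U) F).diff := by
  refine ⟨Submodule.mem_map_of_mem hx.1, ?_⟩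
  rintro _ ⟨y, hy, rfl⟩
  exact ((orthoIsometry d U).inner_map_map y x).trans (hx.2 y hy)

/-- The first `n` columns of an orthogonal matrix. -/
def colFrame (h : n ≤ d) (U : Matrix.orthogonalGroup (Fin d) ℝ) (a : Fin n) :
    EuclideanSpace ℝ (Fin d) :=
  orthoIsometry d U (stdFrame h a)

theorem orthonormal_colFrame (h : n ≤ d) (U : Matrix.orthogonalGroup (Fin d) ℝ) :
    Orthonormal ℝ (colFrame h U) :=
  (orthonormal_stdFrame h).comp_linearIsometryEquiv (orthoIsometry d U)

variable (hij : i ≤ j) (hjd : j ≤ d) (B : GL (Fin d) ℝ) (U : Matrix.orthogonalGroup (Fin d) ℝ)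

theorem span_range_colFrame : Submodule.span ℝ (Set.range (colFrame (hij.trans hjd) U)) =
    (PF.act (Unitary.toUnits U) (coordFlag hij hjd)).lo := by
  change _ = (coordSpace d i).map (lin (Unitary.toUnits U))
  rw [← span_range_stdFrame, Submodule.map_span, ← Set.range_comp]
  rfl

theorem colFrame_natAdd_mem_diff (hn : i + n ≤ j) (a : Fin n) :
    colFrame (hn.trans hjd) U (Fin.natAdd i a) ∈
      (PF.act (Unitary.toUnits U) (coordFlag hij hjd)).diff :=
  orthoIsometry_mem_diff_act U (stdFrame_mem_diff_coordFlag hij hjd _ (Nat.le_add_right i a)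
    ((Nat.add_lt_add_left a.2 i).trans_le hn))

/-- The squared volume of the image under `B` of the cube spanned by the first `n` columns of an
orthogonal matrix. -/
def colVolumeSq (h : n ≤ d) : ℝ := (Matrix.gram ℝ fun a => lin B (colFrame h U a)).det

theorem colVolumeSq_nonneg (h : n ≤ d) : 0 ≤ colVolumeSq B U h :=
  (Matrix.posSemidef_gram ℝ _).det_nonneg

theorem colVolumeSq_add (hn : i + n ≤ j) : colVolumeSq B U (hn.trans hjd) =
    colVolumeSq B U (hij.trans hjd) *
      (Matrix.gram ℝ fun a => perpMap B (PF.act (Unitary.toUnits U) (coordFlag hij hjd))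
        (colFrame (hn.trans hjd) U (Fin.natAdd i a))).det := by
  rw [colVolumeSq, colVolumeSq, ← det_gram_map_sumElim B (span_range_colFrame hij hjd U)
    (colFrame_natAdd_mem_diff hij hjd U hn), ← Matrix.det_submatrix_equiv_self finSumFinEquiv]
  congr 1
  ext (a | a) (b | b) <;> rfl

theorem orthonormal_colFrame_natAdd (h : i + n ≤ d) :
    Orthonormal ℝ fun a : Fin n => colFrame h U (Fin.natAdd i a) :=
  (orthonormal_colFrame h U).comp _ (Fin.natAdd_injective n i)

variable {i : ℕ} (h : i + 2 ≤ d)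

/-- The flag spanned by the first `i` and the first `i + 2` columns of an orthogonal matrix. -/
abbrev colFlag : PF d i (i + 2) :=
  PF.act (Unitary.toUnits U) (coordFlag (Nat.le_add_right i 2) h)

theorem colVolumeSq_add_two : colVolumeSq B U h = colVolumeSq B U (Nat.le_of_add_right_le h) *
    (sv (perpMap B (colFlag U h)) 1 ^ 2 * sv (perpMap B (colFlag U h)) 2 ^ 2) := by
  have hcard : Fintype.card (Fin 2) = finrank ℝ (colFlag U h).diff := by
    have := (colFlag U h).add_finrank_diff
    rw [Fintype.card_fin]
    omega
  rw [colVolumeSq_add (Nat.le_add_right i 2) h B U le_rfl,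
    det_gram_perpMap B (orthonormal_colFrame_natAdd U h) (colFrame_natAdd_mem_diff _ h U le_rfl)
      hcard, Fintype.card_fin, Finset.prod_range_succ, Finset.prod_range_one]

theorem colVolumeSq_add_one_le : colVolumeSq B U (Nat.le_of_succ_le h : i + 1 ≤ d) ≤
    colVolumeSq B U (Nat.le_of_add_right_le h) * sv (perpMap B (colFlag U h)) 1 ^ 2 := by
  rw [colVolumeSq_add (Nat.le_add_right i 2) h B U (Nat.le_succ (i + 1)), Matrix.det_fin_one,
    Matrix.gram_apply, real_inner_self_eq_norm_sq]
  gcongr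
  · exact colVolumeSq_nonneg B U _
  · refine (norm_map_le _ _).trans_eq ?_
    rw [(orthonormal_colFrame _ U).1, mul_one]

/-- The largest squared volume of the image under `B` of an `n`-dimensional unit cube. -/
def svProdSq (n : ℕ) : ℝ := ∏ i ∈ Finset.range n, sv (lin B) (i + 1) ^ 2

theorem colVolumeSq_mul_sv_perpMap_one_sq_le :
    colVolumeSq B U (Nat.le_of_add_right_le h) * sv (perpMap B (colFlag U h)) 1 ^ 2 ≤
      svProdSq B (i + 1) := by
  have hle := det_gram_map_mul_sv_perpMap_one_sq_le B
    (orthonormal_colFrame (Nat.le_of_add_right_le h) U)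
    (span_range_colFrame (Nat.le_add_right i 2) h U) (Nat.lt_add_of_pos_right two_pos)
  rwa [Fintype.card_fin] at hle

end Columns

/-! ### The singular value gap on a random flag -/

section Gap

variable {d n i : ℕ} (B : GL (Fin d) ℝ)

theorem colVolumeSq_le_svProdSq (h : n ≤ d) (U : Matrix.orthogonalGroup (Fin d) ℝ) :
    colVolumeSq B U h ≤ svProdSq B n := by
  have hle := det_gram_map_le (lin B) (orthonormal_colFrame h U)
  rwa [Fintype.card_fin] at hle

theorem svProdSq_pos (h : n ≤ d) : 0 < svProdSq B n :=
  Finset.prod_pos fun _ hi => pow_pos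
    (sv_lin_pos B (Nat.succ_pos _) ((Finset.mem_range.mp hi).trans_le h)) 2

theorem log_svProdSq_succ (h : n + 1 ≤ d) :
    Real.log (svProdSq B (n + 1)) =
      Real.log (svProdSq B n) + 2 * Real.log (sv (lin B) (n + 1)) := by
  rw [svProdSq, Finset.prod_range_succ, ← svProdSq,
    Real.log_mul (svProdSq_pos B (Nat.le_of_succ_le h)).ne'
      (pow_pos (sv_lin_pos B (Nat.succ_pos n) h) 2).ne', Real.log_pow, Nat.cast_ofNat]

/-- The first `n` right singular vectors of `B`. -/
def svFrame (h : n ≤ d) (a : Fin n) : EuclideanSpace ℝ (Fin d) :=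
  svBasis (lin B) (Fin.castLE h a)

theorem orthonormal_svFrame (h : n ≤ d) : Orthonormal ℝ (svFrame B h) :=
  (svBasis (lin B)).orthonormal.comp _ (Fin.castLE_injective h)

theorem svProdSq_mul_frameMinor_sq_le (h : n ≤ d) (U : Matrix.orthogonalGroup (Fin d) ℝ) :
    svProdSq B n * frameMinor (stdFrame h) (svFrame B h) U ^ 2 ≤
      n.factorial * colVolumeSq B U h := by
  have hminor : ((svCoord (lin B) (colFrame h U)).submatrix (Fin.castLE h) id).det =
      frameMinor (stdFrame h) (svFrame B h) U := by
    rw [← Matrix.det_transpose]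
    refine congrArg Matrix.det (Matrix.ext fun a c => ?_)
    exact real_inner_comm (orthoIsometry d U (stdFrame h a)) (svFrame B h c)
  have hle := le_factorial_mul_det_gram_map (lin B) (colFrame h U) (Fin.castLE h)
  simp only [hminor, Fintype.card_fin, Fin.val_castLE] at hle
  rwa [Fin.prod_univ_eq_prod_range fun i => sv (lin B) (i + 1) ^ 2] at hle

/-- An upper bound for the difference between `log (svProdSq B n)` and `log (colVolumeSq B U h)`. -/
def volumeDefect (h : n ≤ d) (U : Matrix.orthogonalGroup (Fin d) ℝ) : ℝ :=
  Real.log n.factorial - 2 * Real.log (frameMinor (stdFrame h) (svFrame B h) U)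

variable {B} in
theorem colVolumeSq_pos {h : n ≤ d} {U : Matrix.orthogonalGroup (Fin d) ℝ}
    (hU : frameMinor (stdFrame h) (svFrame B h) U ≠ 0) : 0 < colVolumeSq B U h :=
  pos_of_mul_pos_right ((mul_pos (svProdSq_pos B h) (sq_pos_of_ne_zero hU)).trans_le
    (svProdSq_mul_frameMinor_sq_le B h U)) (Nat.cast_nonneg _)

variable {B} in
theorem log_colVolumeSq_mem_Icc {h : n ≤ d} {U : Matrix.orthogonalGroup (Fin d) ℝ}
    (hU : frameMinor (stdFrame h) (svFrame B h) U ≠ 0) :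
    Real.log (colVolumeSq B U h) ∈ Set.Icc (Real.log (svProdSq B n) - volumeDefect B h U)
      (Real.log (svProdSq B n)) := by
  have hV := colVolumeSq_pos hU
  have hP := svProdSq_pos B h
  have hfac : (0 : ℝ) < n.factorial := Nat.cast_pos.mpr n.factorial_pos
  refine ⟨?_, Real.log_le_log hV (colVolumeSq_le_svProdSq B h U)⟩
  have hle := Real.log_le_log (by positivity) (svProdSq_mul_frameMinor_sq_le B h U)
  rw [Real.log_mul hP.ne' (by positivity), Real.log_mul hfac.ne' hV.ne', Real.log_pow] at hle
  rw [volumeDefect]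
  push_cast at hle
  linarith

/-- The logarithmic singular value gap of `B` on `V_{i+2} ⊖ V_i`. -/
def flagGap {j : ℕ} (F : PF d i j) : ℝ :=
  Real.log (sv (perpMap B F) 1 / sv (perpMap B F) 2)

theorem two_mul_flagGap_colFlag_mem_Icc (h : i + 2 ≤ d) {U : Matrix.orthogonalGroup (Fin d) ℝ}
    (h0 : 0 < colVolumeSq B U (Nat.le_of_add_right_le h))
    (h1 : 0 < colVolumeSq B U (Nat.le_of_succ_le h)) :
    2 * flagGap B (colFlag U h) + Real.log (colVolumeSq B U (Nat.le_of_add_right_le h)) +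
        Real.log (colVolumeSq B U h) ∈
      Set.Icc (2 * Real.log (colVolumeSq B U (Nat.le_of_succ_le h : i + 1 ≤ d)))
        (2 * Real.log (svProdSq B (i + 1))) := by
  have hs1 := sv_perpMap_pos B (colFlag U h) le_rfl (Nat.le_succ (i + 1))
  have hs2 := sv_perpMap_pos B (colFlag U h) one_le_two le_rfl
  have hlower := Real.log_le_log h1 (colVolumeSq_add_one_le B U h)
  have hupper := Real.log_le_log (by positivity) (colVolumeSq_mul_sv_perpMap_one_sq_le B U h)
  rw [Real.log_mul h0.ne' (by positivity), Real.log_pow] at hlower hupper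
  rw [flagGap, colVolumeSq_add_two, Real.log_div hs1.ne' hs2.ne',
    Real.log_mul h0.ne' (by positivity), Real.log_mul (by positivity) (by positivity),
    Real.log_pow, Real.log_pow]
  push_cast at hlower hupper ⊢
  constructor <;> linarith

/-- The total volume defect in dimensions `i`, `i + 1` and `i + 2`. -/
def gapError (h : i + 2 ≤ d) : Matrix.orthogonalGroup (Fin d) ℝ → ℝ :=
  volumeDefect B (Nat.le_of_add_right_le h : i ≤ d) +
    volumeDefect B (Nat.le_of_succ_le h : i + 1 ≤ d) + volumeDefect B h

theorem abs_flagGap_colFlag_sub_le (h : i + 2 ≤ d) {U : Matrix.orthogonalGroup (Fin d) ℝ}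
    (hU : ∀ n (hn : n ≤ d), frameMinor (stdFrame hn) (svFrame B hn) U ≠ 0) :
    |flagGap B (colFlag U h) - Real.log (sv (lin B) (i + 1) / sv (lin B) (i + 2))| ≤
      gapError B h U := by
  have h0 : i ≤ d := Nat.le_of_add_right_le h
  have h1 : i + 1 ≤ d := Nat.le_of_succ_le h
  obtain ⟨hgap, hgap'⟩ :=
    two_mul_flagGap_colFlag_mem_Icc B h (colVolumeSq_pos (hU i h0)) (colVolumeSq_pos (hU _ h1))
  obtain ⟨hi, hi'⟩ := log_colVolumeSq_mem_Icc (hU i h0)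
  obtain ⟨hi1, -⟩ := log_colVolumeSq_mem_Icc (hU (i + 1) h1)
  obtain ⟨hi2, hi2'⟩ := log_colVolumeSq_mem_Icc (hU (i + 2) h)
  have hprod1 := log_svProdSq_succ B h1
  have hprod2 := log_svProdSq_succ B h
  rw [Real.log_div (sv_lin_pos B (Nat.succ_pos i) h1).ne'
    (sv_lin_pos B (Nat.succ_pos (i + 1)) h).ne', abs_le]
  simp only [gapError, Pi.add_apply]
  constructor <;> linarith

theorem integrable_volumeDefect (h : n ≤ d) : Integrable (volumeDefect B h) (haarO d) :=
  (integrable_const _).sub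
    ((integrable_log_frameMinor (orthonormal_stdFrame h) (orthonormal_svFrame B h)).const_mul 2)

theorem integral_volumeDefect (h : n ≤ d) : ∫ U, volumeDefect B h U ∂(haarO d) =
    ∫ U, volumeDefect 1 h U ∂(haarO d) := by
  have hlog (B : GL (Fin d) ℝ) :=
    integrable_log_frameMinor (orthonormal_stdFrame h) (orthonormal_svFrame B h)
  simp only [volumeDefect]
  rw [integral_sub (integrable_const _) ((hlog B).const_mul 2),
    integral_sub (integrable_const _) ((hlog 1).const_mul 2), integral_const_mul,
    integral_const_mul, integral_log_frameMinor_eq _ (orthonormal_svFrame B h)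
      (orthonormal_svFrame 1 h)]

theorem integrable_gapError (h : i + 2 ≤ d) : Integrable (gapError B h) (haarO d) :=
  ((integrable_volumeDefect B _).add (integrable_volumeDefect B _)).add
    (integrable_volumeDefect B h)

theorem integral_gapError (h : i + 2 ≤ d) :
    ∫ U, gapError B h U ∂(haarO d) = ∫ U, gapError 1 h U ∂(haarO d) := by
  have hsum (B : GL (Fin d) ℝ) : ∫ U, gapError B h U ∂(haarO d) =
      ∫ U, volumeDefect B (Nat.le_of_add_right_le h : i ≤ d) U ∂(haarO d) +
        ∫ U, volumeDefect B (Nat.le_of_succ_le h : i + 1 ≤ d) U ∂(haarO d) +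
          ∫ U, volumeDefect B h U ∂(haarO d) := by
    rw [gapError, integral_add' ((integrable_volumeDefect B _).add (integrable_volumeDefect B _))
      (integrable_volumeDefect B h),
      integral_add' (integrable_volumeDefect B _) (integrable_volumeDefect B _)]
  simp only [hsum, integral_volumeDefect B]

theorem integrable_map_and_abs_integral_sub_le {Ω X : Type*} [MeasurableSpace Ω]
    [MeasurableSpace X] {μ : Measure Ω} [IsProbabilityMeasure μ] {φ : Ω → X} (hφ : Measurable φ)
    {g : X → ℝ} (hg : Measurable g) {R : Ω → ℝ} (hR : Integrable R μ) {c : ℝ}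
    (h : ∀ᵐ ω ∂μ, |g (φ ω) - c| ≤ R ω) :
    Integrable g (μ.map φ) ∧ |∫ x, g x ∂(μ.map φ) - c| ≤ ∫ ω, R ω ∂μ := by
  have hsub : Integrable (fun ω => g (φ ω) - c) μ :=
    hR.mono' ((hg.comp hφ).sub_const c).aestronglyMeasurable h
  have hint : Integrable (fun ω => g (φ ω)) μ :=
    (hsub.add (integrable_const c)).congr (.of_forall fun ω => sub_add_cancel _ c)
  refine ⟨(integrable_map_measure hg.aestronglyMeasurable hφ.aemeasurable).mpr hint, ?_⟩
  have hconst : ∫ ω, (g (φ ω) - c) ∂μ = ∫ ω, g (φ ω) ∂μ - c := by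
    rw [integral_sub hint (integrable_const c), integral_const, probReal_univ, one_smul]
  rw [integral_map hφ.aemeasurable hg.aestronglyMeasurable, ← hconst, ← Real.norm_eq_abs]
  exact norm_integral_le_of_norm_le hR h

theorem measurable_flagGap {k : ℕ} (hk : 1 ≤ k) (hkd : k < d) :
    Measurable fun F : PF d (k - 1) (k + 1) => flagGap B F := by
  have hpair : Measurable fun F : PF d (k - 1) (k + 1) => (B, F) := measurable_prodMk_left
  have hratio := (measurable_sv_perpMap_div hk hkd).comp hpair
  exact hratio.log

theorem integrable_flagGap_and_abs_integral_sub_le (h : i + 2 ≤ d) :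
    Integrable (flagGap B) (haarPF (Nat.le_add_right i 2) h) ∧
      |∫ F, flagGap B F ∂(haarPF (Nat.le_add_right i 2) h) -
        Real.log (sv (lin B) (i + 1) / sv (lin B) (i + 2))| ≤
      ∫ U, gapError 1 h U ∂(haarO d) := by
  have hae : ∀ᵐ U ∂(haarO d), ∀ n (hn : n ≤ d), frameMinor (stdFrame hn) (svFrame B hn) U ≠ 0 :=
    ae_all_iff.mpr fun n => Filter.eventually_all.mpr fun hn =>
      ae_frameMinor_ne_zero (orthonormal_stdFrame hn) (orthonormal_svFrame B hn)
  rw [← integral_gapError B]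
  exact integrable_map_and_abs_integral_sub_le (measurable_orbit _)
    (measurable_flagGap B i.succ_pos h) (integrable_gapError B h)
    (hae.mono fun U hU => abs_flagGap_colFlag_sub_le B h hU)

theorem exists_isGapConstant (d : ℕ) : ∃ C : ℝ, IsGapConstant d C := by
  let c (i : ℕ) : ℝ := if h : i + 2 ≤ d then ∫ U, gapError 1 h U ∂(haarO d) else 0
  refine ⟨∑ i ∈ Finset.range d, |c i|, fun k hk hkd B => ?_⟩
  obtain ⟨i, rfl⟩ := Nat.exists_eq_add_of_le' hk
  obtain ⟨hint, hle⟩ := integrable_flagGap_and_abs_integral_sub_le B hkd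
  refine ⟨hint, hle.trans ?_⟩
  have hc : c i = ∫ U, gapError 1 hkd U ∂(haarO d) := dif_pos _
  rw [← hc]
  exact (le_abs_self _).trans (Finset.single_le_sum (f := fun i => |c i|)
    (fun i _ => abs_nonneg _) (Finset.mem_range.mpr (by omega)))

end Gap

end Miniflag

end

theorem mainTheorem6 (d : ℕ) :
    (∃ C : ℝ, Miniflag.IsGapConstant d C) ∧
    ∀ C : ℝ, Miniflag.IsGapConstant d C →
      ∀ (k : ℕ) (_ : 1 ≤ k) (hkd : k < d) (μ : Measure (GL (Fin d) ℝ)) [IsProbabilityMeasure μ],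
        ∫⁻ F : Miniflag.PF d (k - 1) (k + 1), Miniflag.hFA F μ
            ∂(Miniflag.haarPF (Miniflag.pred_le_succ k) hkd) ≤
          ∫⁻ A, ENNReal.ofReal (Real.log (Miniflag.sv (Miniflag.lin A) k) -
            Real.log (Miniflag.sv (Miniflag.lin A) (k + 1))) ∂μ + ENNReal.ofReal C :=
  ⟨Miniflag.exists_isGapConstant d,
    fun _ hC _ hk hkd μ _ => Miniflag.lintegral_hFA_le hk hkd μ hC⟩
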